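/- Let $p$ be a prime number and let $A$ be a discrete valuation ring whose residue field has characteristic $p$; write $\mathfrak p_A$ for its maximal ideal. A \emph{complete residual perfection} of $A$ is a flat $A$-algebra $C$ that is (separated and) complete with respect to $\mathfrak p_A C$ and for which the $p$-th power map on $\overline C = C/\mathfrak p_A C$ is bijective; these form a full subcategory $\mathrm{CRP}_A$ of the category of $A$-algebras. Let $A^{\mathrm u}$ denote the initial object of $\mathrm{CRP}_A$ (the universal residual perfection). The \emph{generic residual perfection} $A^{\mathrm g}$ of $A$ is the object of $\mathrm{CRP}_A$ whose reduction $\overline{A^{\mathrm g}}$ is, via the map $\overline{A^{\mathrm u}}\to\overline{A^{\mathrm g}}$ induced by $A^{\mathrm u}\to A^{\mathrm g}$, the fraction field of the domain $\overline{A^{\mathrm u}}$. Let $B$ be an extension of $A$, i.e. a discrete valuation ring with an injective local homomorphism $A\to B$. Suppose that the ramification index $e_{B/A}$ is $1$ and that $B/A$ is residually separable, i.e. the (not necessarily algebraic) extension $\ell/k$ of residue fields is separable: $k'\otimes_k \ell$ is reduced for every field extension $k'/k$. Then the generic residual perfections $A^{\mathrm g}$ and $B^{\mathrm g}$ exist,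 and for any choice of them there exists a unique homomorphism $A^{\mathrm g}\to B^{\mathrm g}$ of $A$-algebras. -/

import Mathlib

open IsLocalRing
open scoped TensorProduct

universe u

/-- A (not necessarily algebraic) extension of fields `l / k` is separable if `k' ⊗[k] l` is
reduced for every field extension `k' / k`. For algebraic extensions this is the usual notion. -/
def IsSeparableFieldExtension (k l : Type u) [Field k] [Field l] [Algebra k l] : Prop :=
  ∀ (k' : Type u) [Field k'] [Algebra k k'], IsReduced (k' ⊗[k] l)

section ResidualPerfection

variable (p : ℕ) (A : Type u) [CommRing A] [IsLocalRing A]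

/-- The ideal `𝔭_A C` of an `A`-algebra `C` generated by the maximal ideal of `A`. -/
abbrev extIdeal (C : Type u) [CommRing C] [Algebra A C] : Ideal C :=
  (maximalIdeal A).map (algebraMap A C)

/-- The reduction `C / 𝔭_A C` of an `A`-algebra `C`. -/
abbrev Reduction (C : Type u) [CommRing C] [Algebra A C] : Type u :=
  C ⧸ extIdeal A C

/-- The complete residual perfections of `A` (with residue characteristic `p`):
the flat `A`-algebras `C` that are (separated and) complete for the `𝔭_A C`-adic topology and for
which `x ↦ x ^ p` is bijective on `C / 𝔭_A C`. They form a full subcategory of the category of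
`A`-algebras. -/
structure IsCompleteResidualPerfection (C : Type u) [CommRing C] [Algebra A C] : Prop where
  flat : Module.Flat A C
  complete : IsAdicComplete (extIdeal A C) C
  perfect : PerfectRing (Reduction A C) p

/-- `U` is a universal residual perfection of `A`: an initial object of the category of complete
residual perfections of `A`. -/
structure IsUniversalResidualPerfection (U : Type u) [CommRing U] [Algebra A U] : Prop where
  isCRP : IsCompleteResidualPerfection p A U
  existsUnique_hom : ∀ (C : Type u) [CommRing C] [Algebra A C],
    IsCompleteResidualPerfection p A C → ∃ f : U →ₐ[A] C, ∀ g : U →ₐ[A] C, g = f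

variable {A} in
/-- The ring map `U / 𝔭_A U → C / 𝔭_A C` induced by a map `U → C` of `A`-algebras. -/
def reductionMap {U C : Type u} [CommRing U] [Algebra A U] [CommRing C] [Algebra A C]
    (f : U →ₐ[A] C) : Reduction A U →+* Reduction A C :=
  Ideal.quotientMap (extIdeal A C) f.toRingHom (by
    rw [← Ideal.map_le_iff_le_comap, Ideal.map_map]
    exact (congrArg (fun φ => (maximalIdeal A).map φ) f.comp_algebraMap).le)

/-- A ring map `φ : R → S` makes `S` a fraction field of the domain `R`. -/
def IsFractionFieldMap {R S : Type u} [CommRing R] [CommRing S] (φ : R →+* S) : Prop :=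
  IsDomain R ∧ letI := φ.toAlgebra; IsFractionRing R S

/-- `G` is a generic residual perfection of `A`: the complete residual perfection of `A` that
corresponds to the generic point of the moduli space, i.e. whose reduction is, via the map from
the universal residual perfection `U`, a fraction field of the domain `U / 𝔭_A U`. -/
structure IsGenericResidualPerfection (G : Type u) [CommRing G] [Algebra A G] : Prop where
  isCRP : IsCompleteResidualPerfection p A G
  generic : ∃ (U : Type u) (_ : CommRing U) (_ : Algebra A U) (f : U →ₐ[A] G),
    IsUniversalResidualPerfection p A U ∧ IsFractionFieldMap (reductionMap f)

end ResidualPerfection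

/-! Fix a uniformizer `ϖ` of `A` and lifts `x t` of a `p`-basis of the residue field `k`. In a
complete residual perfection `C`, the `p`-th power map is bijective modulo `ϖ`, so Teichmüller
representatives exist and each `x t` has a unique expansion in powers of `ϖ` with Teichmüller
digits. The digits after the leading one can be chosen freely; the leading one is then forced to be
`x t` minus the tail. Hence `A^u` arises by adjoining perfect variables indexed by `T × ℕ`,
completing, adjoining all `p`-power roots of the forced leading digits, and completing again
(`exists_perfectionModel`, `PerfectionModel.exists_hom`, `PerfectionModel.hom_unique`). Modulo `ϖ`
this is a perfect polynomial ring over `k` with `p`-power roots of the `p`-basis adjoined. It is a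
domain because the basis is `p`-independent, and perfect because the basis generates.

The generic perfection is the completion of `A^u` localized at the prime `(ϖ)`, so a map from `A^u`
extends to it, uniquely, once elements outside `(ϖ)` become units (`existsUnique_extension`). If `e
= 1`, then `ϖ` is a uniformizer of `B` too, so complete residual perfections of `B` are also ones of
`A`, and initiality gives `A^u → B^u`. By MacLane's criterion
(`IsPIndependent.algebraMap_of_isSeparable`), separability keeps the `p`-basis of `k` independent in
`ℓ`, so it extends to a `p`-basis there. Then `A^u → B^u` sends digit variables to distinct digit
variables and is injective modulo `ϖ` (`PerfectionModel.exists_hom_injective`). Elements outside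
`(ϖ)` therefore become units in `B^g`, and the map to `B^g` extends. Uniqueness combines initiality
of `A^u` with uniqueness of the extension. -/

/-! ### Limits and units in rings complete along a principal ideal -/

section AdicDivisibility

variable {C : Type*} [CommRing C] {π : C}

theorem smodEq_span_pow_iff {x y : C} {n : ℕ} :
    x ≡ y [SMOD (Ideal.span {π} ^ n • (⊤ : Ideal C))] ↔ π ^ n ∣ x - y := by
  rw [SModEq.sub_mem, smul_eq_mul, Ideal.mul_top, Ideal.span_singleton_pow,
    Ideal.mem_span_singleton]

theorem eq_zero_of_forall_pow_dvd (hC : IsAdicComplete (Ideal.span {π}) C) {x : C}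
    (hx : ∀ n, π ^ n ∣ x) : x = 0 :=
  hC.toIsHausdorff.haus x fun n => smodEq_span_pow_iff.2 (by simpa using hx n)

theorem eq_of_forall_pow_dvd_sub (hC : IsAdicComplete (Ideal.span {π}) C) {x y : C}
    (hx : ∀ n, π ^ n ∣ x - y) : x = y :=
  sub_eq_zero.1 (eq_zero_of_forall_pow_dvd hC hx)

theorem pow_dvd_sub_of_le {f : ℕ → C} (hf : ∀ n, π ^ n ∣ f (n + 1) - f n) {m n : ℕ}
    (h : m ≤ n) : π ^ m ∣ f n - f m := by
  induction n, h using Nat.le_induction with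
  | base => simp
  | succ n hmn ih =>
    have := dvd_add ((pow_dvd_pow π hmn).trans (hf n)) ih
    simpa using this

theorem exists_limit_of_pow_dvd (hC : IsAdicComplete (Ideal.span {π}) C) {f : ℕ → C}
    (hf : ∀ n, π ^ n ∣ f (n + 1) - f n) : ∃ L, ∀ n, π ^ n ∣ L - f n := by
  obtain ⟨L, hL⟩ := hC.toIsPrecomplete.prec (f := f) fun {m n} h =>
    smodEq_span_pow_iff.2 ((dvd_sub_comm).1 (pow_dvd_sub_of_le hf h))
  exact ⟨L, fun n => (dvd_sub_comm).1 (smodEq_span_pow_iff.1 (hL n))⟩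

/-- Completeness puts `π` in the Jacobson radical, so inverses modulo `π` suffice. -/
theorem isUnit_of_dvd_mul_sub_one (hC : IsAdicComplete (Ideal.span {π}) C) {x y : C}
    (h : π ∣ x * y - 1) : IsUnit x := by
  have hj := IsAdicComplete.le_jacobson_bot (Ideal.span {π}) (Ideal.mem_span_singleton.2 h)
  rw [Ideal.mem_jacobson_bot] at hj
  have := hj 1
  rw [mul_one, sub_add_cancel] at this
  exact isUnit_of_mul_isUnit_left this

end AdicDivisibility

/-! ### Completion along a nonzerodivisor -/

/-- A ring map `h : R → G` that identifies `R / ϖ` with `G / h ϖ`, where `h ϖ` is a nonzerodivisor: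
if `G` is `h ϖ`-adically complete it is the completion of `R`. -/
structure IsAdicDense {R G : Type*} [CommRing R] [CommRing G] (h : R →+* G) (ϖ : R) : Prop where
  regular : ∀ x, h ϖ * x = 0 → x = 0
  surj : ∀ g, ∃ r, h ϖ ∣ g - h r
  dvd : ∀ r, h ϖ ∣ h r → ϖ ∣ r

namespace IsAdicDense

variable {R G C : Type*} [CommRing R] [CommRing G] [CommRing C] {h : R →+* G} {ϖ : R}

theorem exists_approx (H : IsAdicDense h ϖ) (n : ℕ) (g : G) : ∃ r, h ϖ ^ n ∣ g - h r := by
  induction n generalizing g with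
  | zero => exact ⟨0, by simp⟩
  | succ n ih =>
    obtain ⟨r, s, hs⟩ := H.surj g
    obtain ⟨r', s', hs'⟩ := ih s
    refine ⟨r + ϖ * r', s', ?_⟩
    rw [map_add, map_mul, ← sub_sub, hs, ← mul_sub, hs']
    ring

/-- `dvd` extracts one factor `ϖ` and `regular` cancels it in `G`; repeat. -/
theorem pow_dvd (H : IsAdicDense h ϖ) (n : ℕ) (r : R) (hr : h ϖ ^ n ∣ h r) : ϖ ^ n ∣ r := by
  induction n generalizing r with
  | zero => simp
  | succ n ih =>
    obtain ⟨s, rfl⟩ := H.dvd r ((dvd_pow_self _ (by simp)).trans hr)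
    obtain ⟨x, hx⟩ := hr
    rw [pow_succ', mul_assoc, map_mul, ← sub_eq_zero, ← mul_sub] at hx
    rw [pow_succ']
    exact mul_dvd_mul_left _ (ih s ⟨x, sub_eq_zero.1 (H.regular _ hx)⟩)

theorem lift_unique (H : IsAdicDense h ϖ) {f g : G →+* C}
    (hC : IsAdicComplete (Ideal.span {f (h ϖ)}) C) (hfg : f.comp h = g.comp h) : f = g := by
  ext x
  refine eq_of_forall_pow_dvd_sub hC fun n => ?_
  obtain ⟨r, y, hy⟩ := H.exists_approx n x
  obtain rfl := sub_eq_iff_eq_add.1 hy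
  have e (r : R) : g (h r) = f (h r) := (congrArg (fun φ : R →+* C => φ r) hfg).symm
  refine ⟨f y - g y, ?_⟩
  simp only [map_add, map_mul, map_pow, e]
  ring

/-- The value at `g` is the limit of `ψ r` over approximants `r` of `g`. By `pow_dvd`, two
approximants modulo `h ϖ ^ n` have images congruent modulo `ψ ϖ ^ n`, so the limit does not depend
on choices and is a ring homomorphism. -/
theorem exists_lift (H : IsAdicDense h ϖ) (ψ : R →+* C)
    (hC : IsAdicComplete (Ideal.span {ψ ϖ}) C) : ∃ Ψ : G →+* C, Ψ.comp h = ψ := by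
  have key (n : ℕ) (r s : R) (g : G) (hr : h ϖ ^ n ∣ g - h r) (hs : h ϖ ^ n ∣ g - h s) :
      ψ ϖ ^ n ∣ ψ r - ψ s := by
    have := dvd_sub hs hr
    rw [sub_sub_sub_cancel_left, ← map_sub] at this
    simpa using map_dvd ψ (H.pow_dvd n _ this)
  have lim (g : G) : ∃ L : C, ∀ n r, h ϖ ^ n ∣ g - h r → ψ ϖ ^ n ∣ L - ψ r := by
    choose r hr using fun n => H.exists_approx n g
    obtain ⟨L, hL⟩ := exists_limit_of_pow_dvd hC (f := fun n => ψ (r n)) fun n =>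
      key n _ _ g ((pow_dvd_pow _ n.le_succ).trans (hr _)) (hr n)
    refine ⟨L, fun n s hs => ?_⟩
    simpa using dvd_add (hL n) (key n _ _ g (hr n) hs)
  choose L hL using lim
  have uniq (g : G) (y : C) (hy : ∀ n r, h ϖ ^ n ∣ g - h r → ψ ϖ ^ n ∣ y - ψ r) : L g = y := by
    refine eq_of_forall_pow_dvd_sub hC fun n => ?_
    obtain ⟨r, hr⟩ := H.exists_approx n g
    simpa using dvd_sub (hL g n r hr) (hy n r hr)
  have hof (r : R) : L (h r) = ψ r := by
    refine uniq _ _ fun n s hs => ?_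
    rw [← map_sub] at hs ⊢
    simpa using map_dvd ψ (H.pow_dvd n _ hs)
  have uniq' (g : G) (y : C) (hy : ∀ n, ∃ r, h ϖ ^ n ∣ g - h r ∧ ψ ϖ ^ n ∣ y - ψ r) :
      L g = y := by
    refine uniq g y fun n r hr => ?_
    obtain ⟨s, hs, hs'⟩ := hy n
    simpa using dvd_add hs' (key n _ _ g hs hr)
  refine ⟨{ toFun := L, map_one' := ?_, map_mul' := ?_, map_zero' := ?_, map_add' := ?_ }, ?_⟩
  · simpa using hof 1
  · intro x y
    refine uniq' _ _ fun n => ?_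
    obtain ⟨r, hr⟩ := H.exists_approx n x
    obtain ⟨s, hs⟩ := H.exists_approx n y
    refine ⟨r * s, ?_, ?_⟩
    · have := dvd_add (hr.mul_right y) (hs.mul_left (h r))
      rw [map_mul]
      convert this using 1; ring
    · have := dvd_add ((hL x n r hr).mul_right (L y)) ((hL y n s hs).mul_left (ψ r))
      rw [map_mul]
      convert this using 1; ring
  · simpa using hof 0
  · intro x y
    refine uniq' _ _ fun n => ?_
    obtain ⟨r, hr⟩ := H.exists_approx n x
    obtain ⟨s, hs⟩ := H.exists_approx n y
    refine ⟨r + s, ?_, ?_⟩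
    · rw [map_add, add_sub_add_comm]
      exact dvd_add hr hs
    · rw [map_add, add_sub_add_comm]
      exact dvd_add (hL x n r hr) (hL y n s hs)
  · ext r
    exact hof r

end IsAdicDense

theorem exists_adicCompletion (R : Type u) [CommRing R] (ϖ : R) (hϖ : ∀ x, ϖ * x = 0 → x = 0) :
    ∃ (G : Type u) (_ : CommRing G) (h : R →+* G),
      IsAdicDense h ϖ ∧ IsAdicComplete (Ideal.span {h ϖ}) G := by
  have fg : (Ideal.span {ϖ} : Ideal R).FG := ⟨{ϖ}, by simp⟩
  have hmap : (Ideal.span {ϖ}).map (algebraMap R (AdicCompletion (Ideal.span {ϖ}) R)) =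
      Ideal.span {algebraMap R (AdicCompletion (Ideal.span {ϖ}) R) ϖ} := by
    rw [Ideal.map_span, Set.image_singleton]
  have hker (x : AdicCompletion (Ideal.span {ϖ}) R)
      (hx : AdicCompletion.evalOneₐ (Ideal.span {ϖ}) x = 0) :
      algebraMap R (AdicCompletion (Ideal.span {ϖ}) R) ϖ ∣ x := by
    rw [← Ideal.mem_span_singleton, ← hmap, ← AdicCompletion.ker_evalOneₐ_eq_map _ fg]
    exact hx
  refine ⟨AdicCompletion (Ideal.span {ϖ}) R, inferInstance, algebraMap _ _, ⟨?_, ?_, ?_⟩, ?_⟩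
  · intro x hx
    induction x using AdicCompletion.induction_on with
    | _ f =>
    refine AdicCompletion.ext_evalₐ fun n => ?_
    have h1 := congrArg (AdicCompletion.evalₐ (Ideal.span {ϖ}) (n + 1)) hx
    rw [map_mul, AlgHom.commutes, AdicCompletion.evalₐ_mk, map_zero,
      Ideal.Quotient.algebraMap_eq, ← map_mul, Ideal.Quotient.eq_zero_iff_mem,
      Ideal.span_singleton_pow, Ideal.mem_span_singleton] at h1
    -- Cancelling `ϖ` costs one power, so the sequence is inspected at `n + 1` to obtain vanishing
    -- at level `n`.
    have h2 : ϖ ^ n ∣ f (n + 1) := by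
      obtain ⟨y, hy⟩ := h1
      rw [pow_succ', mul_assoc, ← sub_eq_zero, ← mul_sub] at hy
      exact ⟨y, sub_eq_zero.1 (hϖ _ hy)⟩
    have h3 := smodEq_span_pow_iff.1 (f.2 n.le_succ)
    rw [AdicCompletion.evalₐ_mk, map_zero, Ideal.Quotient.eq_zero_iff_mem,
      Ideal.span_singleton_pow, Ideal.mem_span_singleton]
    simpa using dvd_add h3 h2
  · intro g
    obtain ⟨r, hr⟩ := Ideal.Quotient.mk_surjective (AdicCompletion.evalOneₐ (Ideal.span {ϖ}) g)
    refine ⟨r, hker _ ?_⟩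
    rw [map_sub, AlgHom.commutes, ← hr, Ideal.Quotient.algebraMap_eq, sub_self]
  · rintro r ⟨y, hy⟩
    have := congrArg (AdicCompletion.evalOneₐ (Ideal.span {ϖ})) hy
    rw [map_mul, AlgHom.commutes, AlgHom.commutes, Ideal.Quotient.algebraMap_eq] at this
    rw [← Ideal.mem_span_singleton, ← Ideal.Quotient.eq_zero_iff_mem, this]
    rw [Ideal.Quotient.eq_zero_iff_mem.2 (Ideal.mem_span_singleton_self ϖ), zero_mul]
  · rw [← hmap]
    exact (IsAdicComplete.map_algebraMap_iff (S := AdicCompletion (Ideal.span {ϖ}) R)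
      (Ideal.span {ϖ}) (AdicCompletion (Ideal.span {ϖ}) R)).2 (AdicCompletion.isAdicComplete fg)

/-! ### Free perfect commutative monoids -/

section PerfectMonoid

variable {p : ℕ} {M N : Type*} [CommMonoid M] [CommMonoid N]

theorem pow_pow_injective [PerfectRing N p] (n : ℕ) {x y : N} (h : x ^ p ^ n = y ^ p ^ n) :
    x = y :=
  (PerfectRing.pow N p n).bijective_frobenius.injective h

theorem exists_pow_pow_eq [PerfectRing N p] (n : ℕ) (x : N) : ∃ y : N, y ^ p ^ n = x :=
  (PerfectRing.pow N p n).bijective_frobenius.surjective x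

/-- The additive monoid of nonnegative rational numbers whose denominator is a power of `p`. -/
def pFractions (p : ℕ) [Fact p.Prime] : AddSubmonoid ℚ where
  carrier := {q | ∃ n m : ℕ, q * (p : ℚ) ^ n = m}
  zero_mem' := ⟨0, 0, by simp⟩
  add_mem' := by
    rintro a b ⟨n, m, h⟩ ⟨n', m', h'⟩
    refine ⟨n + n', m * p ^ n' + m' * p ^ n, ?_⟩
    push_cast
    rw [← h, ← h', pow_add]
    ring

variable [hp : Fact p.Prime]

theorem prime_cast_ne_zero : (p : ℚ) ≠ 0 := Nat.cast_ne_zero.2 hp.out.ne_zero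

theorem one_mem_pFractions : (1 : ℚ) ∈ pFractions p := ⟨0, 1, by simp⟩

instance : One (pFractions p) := ⟨⟨1, one_mem_pFractions⟩⟩

theorem pFractions.coe_one : ((1 : pFractions p) : ℚ) = 1 := rfl

theorem pFractions.nonneg (q : pFractions p) : 0 ≤ (q : ℚ) := by
  obtain ⟨n, m, h⟩ := q.2
  have : (q : ℚ) = m / (p : ℚ) ^ n := by
    rw [← h, mul_div_cancel_right₀ _ (pow_ne_zero _ prime_cast_ne_zero)]
  rw [this]
  positivity

theorem exists_nsmul_eq (q : pFractions p) : ∃ r : pFractions p, p • r = q := by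
  obtain ⟨n, m, h⟩ := q.2
  refine ⟨⟨q / p, n + 1, m, ?_⟩, ?_⟩
  · rw [← h]
    have := prime_cast_ne_zero (p := p)
    field_simp
    ring
  · apply Subtype.ext
    simp only [AddSubmonoidClass.coe_nsmul, nsmul_eq_mul]
    have := prime_cast_ne_zero (p := p)
    field_simp

theorem nsmul_pFractions_injective {q r : pFractions p} (h : p • q = p • r) : q = r := by
  have := congrArg (fun x : pFractions p => (x : ℚ)) h
  simp only [AddSubmonoidClass.coe_nsmul, nsmul_eq_mul] at this
  exact Subtype.ext (mul_left_cancel₀ prime_cast_ne_zero this)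

theorem nsmul_finsupp_pFractions_injective {J : Type*} {q r : J →₀ pFractions p}
    (h : p • q = p • r) : q = r := by
  ext j : 1
  exact nsmul_pFractions_injective (DFunLike.congr_fun h j)

theorem exists_nsmul_finsupp_eq {J : Type*} (q : J →₀ pFractions p) :
    ∃ r : J →₀ pFractions p, p • r = q := by
  choose f hf using exists_nsmul_eq (p := p)
  have hf0 : f 0 = 0 := nsmul_pFractions_injective (by rw [hf, nsmul_zero])
  refine ⟨q.mapRange f hf0, ?_⟩
  ext j : 1
  simp [hf]

instance {J : Type*} : PerfectRing (Multiplicative (J →₀ pFractions p)) p :=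
  ⟨fun _ _ h => nsmul_finsupp_pFractions_injective (p := p) h,
    fun x => exists_nsmul_finsupp_eq (p := p) (Multiplicative.toAdd x)⟩

/-- An exponent `m / p ^ n` goes to the unique `p ^ n`-th root of `a ^ m`; uniqueness of roots gives
independence of the fraction and additivity. -/
theorem exists_addMonoidHom_pFractions [PerfectRing N p] (a : N) :
    ∃ f : pFractions p →+ Additive N, f 1 = Additive.ofMul a := by
  have key (q : pFractions p) : ∃ y : N, ∀ n m : ℕ, (q : ℚ) * (p : ℚ) ^ n = m →
      y ^ p ^ n = a ^ m := by
    obtain ⟨n, m, h⟩ := q.2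
    obtain ⟨y, hy⟩ := exists_pow_pow_eq (p := p) n (a ^ m)
    refine ⟨y, fun n' m' h' => pow_pow_injective (p := p) n ?_⟩
    rw [← pow_mul, mul_comm, pow_mul, hy, ← pow_mul, ← pow_mul]
    congr 1
    have : (m * p ^ n' : ℚ) = m' * p ^ n := by rw [← h, ← h']; ring
    exact_mod_cast this
  choose f hf using key
  refine ⟨{ toFun := fun q => Additive.ofMul (f q), map_zero' := ?_, map_add' := ?_ }, ?_⟩
  · have := hf 0 0 0 (by simp)
    simpa using this
  · intro q r
    obtain ⟨n, m, h⟩ := q.2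
    obtain ⟨n', m', h'⟩ := r.2
    rw [← ofMul_mul, Additive.ofMul.apply_eq_iff_eq]
    refine pow_pow_injective (p := p) (n + n') ?_
    rw [mul_pow, hf q (n + n') (m * p ^ n') (by push_cast; rw [← h]; ring),
      hf r (n + n') (m' * p ^ n) (by push_cast; rw [← h']; ring), ← pow_add]
    refine hf _ _ _ ?_
    push_cast
    rw [← h, ← h']
    ring
  · have := hf 1 0 1 (by simp [pFractions.coe_one])
    simpa using this

/-- With the extensionality below, this makes the fractional exponents the free perfect commutative
monoid on `J`. -/
theorem exists_monoidHom_finsupp_pFractions [PerfectRing N p] {J : Type*} (a : J → N) :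
    ∃ f : Multiplicative (J →₀ pFractions p) →* N,
      ∀ j, f (Multiplicative.ofAdd (Finsupp.single j 1)) = a j := by
  choose f hf using fun j => exists_addMonoidHom_pFractions (p := p) (a j)
  refine ⟨AddMonoidHom.toMultiplicativeLeft (Finsupp.liftAddHom f), fun j => ?_⟩
  change (Finsupp.liftAddHom f (Finsupp.single j 1)).toMul = a j
  rw [Finsupp.liftAddHom_apply_single, hf]
  rfl

theorem monoidHom_finsupp_pFractions_ext [PerfectRing N p] {J : Type*}
    {f g : Multiplicative (J →₀ pFractions p) →* N}
    (h : ∀ j, f (Multiplicative.ofAdd (Finsupp.single j 1)) =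
      g (Multiplicative.ofAdd (Finsupp.single j 1))) : f = g := by
  suffices AddMonoidHom.toMultiplicativeLeft.symm f =
      AddMonoidHom.toMultiplicativeLeft.symm g from
    AddMonoidHom.toMultiplicativeLeft.symm.injective this
  ext j q : 2
  obtain ⟨n, m, hq⟩ := q.2
  have hs : p ^ n • (Finsupp.single j q : J →₀ pFractions p) = m • Finsupp.single j 1 := by
    rw [Finsupp.smul_single, Finsupp.smul_single]
    congr 1
    apply Subtype.ext
    simp only [AddSubmonoidClass.coe_nsmul, nsmul_eq_mul, pFractions.coe_one, mul_one, ← hq]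
    push_cast
    ring
  change f (Multiplicative.ofAdd (Finsupp.single j q)) =
    g (Multiplicative.ofAdd (Finsupp.single j q))
  refine pow_pow_injective (p := p) n ?_
  rw [← map_pow f, ← map_pow g, ← ofAdd_nsmul, hs, ofAdd_nsmul, map_pow f, map_pow g, h]

end PerfectMonoid

/-! ### Teichmüller lifts of multiplicative maps -/

section Teichmuller

variable {p : ℕ} {C M : Type*} [CommRing C] [CommMonoid M] {π : C}

theorem pow_succ_dvd_pow_pow_sub (hp : π ∣ (p : C)) {x y : C} (h : π ∣ x - y) (n : ℕ) :
    π ^ (n + 1) ∣ x ^ p ^ n - y ^ p ^ n := by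
  have := SModEq.pow_pow_add_one (I := Ideal.span {π}) (Ideal.mem_span_singleton.2 hp)
    (x := x) (y := y) (by rwa [SModEq.sub_mem, Ideal.mem_span_singleton]) n
  rwa [SModEq.sub_mem, Ideal.span_singleton_pow, Ideal.mem_span_singleton] at this

/-- Every element is a `p ^ n`-th power, and raising to that power improves a congruence modulo `π`
to one modulo `π ^ (n + 1)`. -/
theorem monoidHom_ext_of_dvd_sub [PerfectRing M p] (hC : IsAdicComplete (Ideal.span {π}) C)
    (hp : π ∣ (p : C)) {f g : M →* C} (h : ∀ m, π ∣ f m - g m) : f = g := by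
  ext m
  refine eq_of_forall_pow_dvd_sub hC fun n => ?_
  obtain ⟨r, rfl⟩ := exists_pow_pow_eq (p := p) n m
  rw [map_pow, map_pow]
  exact (pow_dvd_pow π n.le_succ).trans (pow_succ_dvd_pow_pow_sub hp (h r) n)

/-- Teichmüller's construction: lift `χ` of the `p ^ n`-th root of `m` arbitrarily, raise to the
power `p ^ n`, and let `n` grow. The limit is independent of the lifts, hence multiplicative. -/
theorem exists_monoidHom_lift [PerfectRing M p] (hC : IsAdicComplete (Ideal.span {π}) C)
    (hp : π ∣ (p : C)) (χ : M →* C ⧸ Ideal.span {π}) :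
    ∃ f : M →* C, ∀ m, Ideal.Quotient.mk _ (f m) = χ m := by
  have hmk {x y : C} : Ideal.Quotient.mk (Ideal.span {π}) x = Ideal.Quotient.mk _ y ↔
      π ∣ x - y := by
    rw [Ideal.Quotient.mk_eq_mk_iff_sub_mem, Ideal.mem_span_singleton]
  have lim (m : M) : ∃ y : C, ∀ (n : ℕ) (r : M) (z : C), r ^ p ^ n = m →
      Ideal.Quotient.mk _ z = χ r → π ^ (n + 1) ∣ y - z ^ p ^ n := by
    choose r hr using fun n => exists_pow_pow_eq (p := p) n m
    choose z hz using fun n => Ideal.Quotient.mk_surjective (χ (r n))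
    obtain ⟨y, hy⟩ := exists_limit_of_pow_dvd hC (f := fun n => z n ^ p ^ n) fun n => by
      rw [pow_succ', pow_mul]
      refine (pow_dvd_pow π n.le_succ).trans (pow_succ_dvd_pow_pow_sub hp (hmk.1 ?_) n)
      rw [map_pow, hz, hz, ← map_pow]
      congr 1
      refine pow_pow_injective (p := p) n ?_
      rw [← pow_mul, ← pow_succ', hr, hr]
    refine ⟨y, fun n s w hs hw => ?_⟩
    have h1 := hy (n + 1)
    have h2 : π ^ (n + 1) ∣ z (n + 1) ^ p ^ (n + 1) - w ^ p ^ n := by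
      rw [pow_succ' p n, pow_mul]
      refine pow_succ_dvd_pow_pow_sub hp (hmk.1 ?_) n
      rw [map_pow, hz, hw, ← map_pow]
      congr 1
      refine pow_pow_injective (p := p) n ?_
      rw [← pow_mul, ← pow_succ', hr, hs]
    simpa using dvd_add h1 h2
  choose f hf using lim
  have uniq (m : M) (y : C) (hy : ∀ n, ∃ (r : M) (z : C), r ^ p ^ n = m ∧
      Ideal.Quotient.mk _ z = χ r ∧ π ^ (n + 1) ∣ y - z ^ p ^ n) : f m = y := by
    refine eq_of_forall_pow_dvd_sub hC fun n => ?_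
    obtain ⟨r, z, h1, h2, h3⟩ := hy n
    have := dvd_sub (hf m n r z h1 h2) h3
    rw [sub_sub_sub_cancel_right] at this
    exact (pow_dvd_pow π n.le_succ).trans this
  refine ⟨{ toFun := f, map_one' := ?_, map_mul' := ?_ }, fun m => ?_⟩
  · exact uniq _ _ fun n => ⟨1, 1, by simp, by simp, by simp⟩
  · intro a b
    refine uniq _ _ fun n => ?_
    obtain ⟨r, hr⟩ := exists_pow_pow_eq (p := p) n a
    obtain ⟨s, hs⟩ := exists_pow_pow_eq (p := p) n b
    obtain ⟨y, hy⟩ := Ideal.Quotient.mk_surjective (χ r)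
    obtain ⟨z, hz⟩ := Ideal.Quotient.mk_surjective (χ s)
    refine ⟨r * s, y * z, by rw [mul_pow, hr, hs], by rw [map_mul, map_mul, hy, hz], ?_⟩
    have := dvd_add ((hf a n r y hr hy).mul_right (f b)) ((hf b n s z hs hz).mul_left (y ^ p ^ n))
    convert this using 1
    ring
  · obtain ⟨z, hz⟩ := Ideal.Quotient.mk_surjective (χ m)
    have := hf m 0 m z (by simp) hz
    rw [← hz]
    exact hmk.2 (by simpa using this)

end Teichmuller

/-! ### Integral and fractional parts of exponents -/

section FloorFract

variable {p : ℕ} [hp : Fact p.Prime] {T : Type*}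

theorem pFractions.coe_nsmul_one (n : ℕ) : ((n • (1 : pFractions p) : pFractions p) : ℚ) = n := by
  simp [pFractions.coe_one]

/-- The integral part of an element of `pFractions p`. -/
noncomputable def pFractions.floor (q : pFractions p) : ℕ := ⌊(q : ℚ)⌋₊

/-- The fractional part of an element of `pFractions p`. -/
noncomputable def pFractions.fract (q : pFractions p) : pFractions p :=
  ⟨q - ⌊(q : ℚ)⌋₊, by
    obtain ⟨n, m, h⟩ := q.2
    refine ⟨n, m - ⌊(q : ℚ)⌋₊ * p ^ n, ?_⟩
    have hle : ⌊(q : ℚ)⌋₊ * p ^ n ≤ m := by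
      have := mul_le_mul_of_nonneg_right (Nat.floor_le (pFractions.nonneg q))
        (pow_nonneg (Nat.cast_nonneg (α := ℚ) p) n)
      rw [h] at this
      exact_mod_cast this
    rw [Nat.cast_sub hle, sub_mul, h]
    push_cast
    ring⟩

theorem pFractions.floor_add_fract (q : pFractions p) :
    (pFractions.floor q) • (1 : pFractions p) + (pFractions.fract q) = q := by
  apply Subtype.ext
  rw [AddSubmonoid.coe_add, pFractions.coe_nsmul_one]
  simp [pFractions.floor, pFractions.fract]

theorem pFractions.floor_nsmul_one_add (n : ℕ) (q : pFractions p) :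
    pFractions.floor (n • (1 : pFractions p) + q) = n + (pFractions.floor q) := by
  rw [pFractions.floor, AddSubmonoid.coe_add, pFractions.coe_nsmul_one, pFractions.floor,
    add_comm, Nat.floor_add_natCast (pFractions.nonneg q), add_comm]

theorem pFractions.fract_nsmul_one_add (n : ℕ) (q : pFractions p) :
    pFractions.fract (n • (1 : pFractions p) + q) = (pFractions.fract q) := by
  have h := pFractions.floor_add_fract (n • (1 : pFractions p) + q)
  have h' := pFractions.floor_add_fract q
  rw [pFractions.floor_nsmul_one_add] at h
  nth_rw 3 [← h'] at h
  rw [← add_assoc, ← add_nsmul] at h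
  exact add_left_cancel h

theorem pFractions.fract_lt_one (q : pFractions p) : ((pFractions.fract q) : ℚ) < 1 := by
  simp only [pFractions.fract]
  linarith [Nat.lt_floor_add_one (q : ℚ)]

theorem pFractions.floor_zero : pFractions.floor (0 : pFractions p) = 0 := by
  simp [pFractions.floor]

theorem pFractions.fract_zero : pFractions.fract (0 : pFractions p) = 0 := by
  apply Subtype.ext
  simp [pFractions.fract]

/-- The inclusion of integral exponents into fractional ones. -/
noncomputable def natExponent (p : ℕ) [Fact p.Prime] (T : Type*) :
    (T →₀ ℕ) →+ (T →₀ pFractions p) :=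
  Finsupp.mapRange.addMonoidHom (multiplesHom _ 1)

theorem natExponent_single (t : T) :
    natExponent p T (Finsupp.single t 1) = Finsupp.single t 1 := by
  simp [natExponent]

/-- The coordinatewise integral part. -/
noncomputable def exponentFloor (g : T →₀ pFractions p) : T →₀ ℕ :=
  g.mapRange pFractions.floor pFractions.floor_zero

/-- The coordinatewise fractional part. -/
noncomputable def exponentFract (g : T →₀ pFractions p) : T →₀ pFractions p :=
  g.mapRange pFractions.fract pFractions.fract_zero

theorem exponentFloor_add_fract (g : T →₀ pFractions p) :
    natExponent p T (exponentFloor g) + exponentFract g = g := by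
  ext t : 1
  exact pFractions.floor_add_fract (g t)

theorem exponentFloor_natExponent_add (ν : T →₀ ℕ) (g : T →₀ pFractions p) :
    exponentFloor (natExponent p T ν + g) = ν + exponentFloor g := by
  ext t : 1
  exact pFractions.floor_nsmul_one_add (ν t) (g t)

theorem exponentFract_natExponent_add (ν : T →₀ ℕ) (g : T →₀ pFractions p) :
    exponentFract (natExponent p T ν + g) = exponentFract g := by
  ext t : 1
  exact pFractions.fract_nsmul_one_add (ν t) (g t)

theorem exponentFract_fract (g : T →₀ pFractions p) :
    exponentFract (exponentFract g) = exponentFract g := by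
  conv_rhs => rw [← exponentFloor_add_fract g, exponentFract_natExponent_add]

theorem exponentFract_zero : exponentFract (0 : T →₀ pFractions p) = 0 := by
  simp [exponentFract]

theorem exponentFloor_zero : exponentFloor (0 : T →₀ pFractions p) = 0 := by
  simp [exponentFloor]

theorem exponentFloor_nsmul_lt {g : T →₀ pFractions p} (hg : exponentFract g = g) (t : T) :
    exponentFloor (p • g) t < p := by
  change ⌊((p • g t : pFractions p) : ℚ)⌋₊ < p
  have h1 : (g t : ℚ) < 1 := by
    rw [← hg]
    exact pFractions.fract_lt_one (g t)
  have h0 := prime_cast_ne_zero (p := p)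
  have h2 : (0 : ℚ) < p := lt_of_le_of_ne (Nat.cast_nonneg p) h0.symm
  rw [AddSubmonoidClass.coe_nsmul, nsmul_eq_mul,
    Nat.floor_lt (mul_nonneg h2.le (pFractions.nonneg (g t)))]
  nlinarith

theorem exists_pow_nsmul_eq_natExponent (g : T →₀ pFractions p) :
    ∃ (n : ℕ) (ν : T →₀ ℕ), p ^ n • g = natExponent p T ν := by
  induction g using Finsupp.induction_linear with
  | zero => exact ⟨0, 0, by simp⟩
  | add f g hf hg =>
    obtain ⟨n, ν, h⟩ := hf
    obtain ⟨n', ν', h'⟩ := hg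
    refine ⟨n + n', p ^ n' • ν + p ^ n • ν', ?_⟩
    rw [map_add, map_nsmul, map_nsmul, ← h, ← h', smul_add, ← mul_smul, ← mul_smul, pow_add,
      mul_comm (p ^ n')]
  | single t q =>
    obtain ⟨n, m, h⟩ := q.2
    refine ⟨n, Finsupp.single t m, ?_⟩
    rw [natExponent, Finsupp.mapRange.addMonoidHom_apply, Finsupp.mapRange_single,
      Finsupp.smul_single]
    congr 1
    apply Subtype.ext
    rw [multiplesHom_apply, pFractions.coe_nsmul_one, AddSubmonoidClass.coe_nsmul, nsmul_eq_mul,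
      ← h]
    push_cast
    ring

end FloorFract

/-! ### Adjoining `p`-power roots: universal property and coordinates -/

section RootAlgebra

open AddMonoidAlgebra

variable (p : ℕ) [hp : Fact p.Prime] {T B C : Type*} [CommRing B] [CommRing C]

/-- The `B`-algebra obtained from `B` by adjoining, for each `t`, a compatible system of
`p`-power roots of `d t`. -/
def RootAlgebra (d : T → B) : Type _ :=
  AddMonoidAlgebra B (T →₀ pFractions p) ⧸ Ideal.span (Set.range fun t =>
    (single (Finsupp.single t 1) 1 - single 0 (d t) : AddMonoidAlgebra B (T →₀ pFractions p)))

namespace RootAlgebra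

variable (d : T → B)

noncomputable instance : CommRing (RootAlgebra p d) :=
  inferInstanceAs (CommRing (_ ⧸ _))

/-- The presentation of the root algebra. -/
noncomputable def mk : AddMonoidAlgebra B (T →₀ pFractions p) →+* RootAlgebra p d :=
  Ideal.Quotient.mk _

theorem mk_surjective : Function.Surjective (mk p d) := Ideal.Quotient.mk_surjective

/-- The structure map of the root algebra. -/
noncomputable def base : B →+* RootAlgebra p d :=
  (mk p d).comp singleZeroRingHom

/-- The universal `p`-power roots. -/
noncomputable def root : Multiplicative (T →₀ pFractions p) →* RootAlgebra p d :=
  (mk p d : _ →* RootAlgebra p d).comp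
    (AddMonoidAlgebra.of B (T →₀ pFractions p))

theorem mk_single (g : T →₀ pFractions p) (b : B) :
    mk p d (single g b) = base p d b * root p d (Multiplicative.ofAdd g) := by
  change _ = mk p d (single 0 b) * mk p d (single g 1)
  rw [← map_mul, single_mul_single, zero_add, mul_one]

theorem root_single_one (t : T) :
    root p d (Multiplicative.ofAdd (Finsupp.single t 1)) = base p d (d t) :=
  Ideal.Quotient.eq.2 (Ideal.subset_span ⟨t, rfl⟩)

variable {p d} in
theorem induction {P : RootAlgebra p d → Prop} (x : RootAlgebra p d)
    (hmul : ∀ b g, P (base p d b * root p d g)) (hadd : ∀ x y, P x → P y → P (x + y)) : P x := by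
  obtain ⟨y, rfl⟩ := mk_surjective p d x
  induction y using AddMonoidAlgebra.induction_linear with
  | zero => simpa [map_zero (base p d), map_zero (mk p d)] using hmul 0 1
  | add f g hf hg => rw [map_add]; exact hadd _ _ hf hg
  | single g b => rw [mk_single]; exact hmul _ _

/-- The universal property of the root algebra. -/
noncomputable def lift (f : B →+* C) (g : Multiplicative (T →₀ pFractions p) →* C)
    (h : ∀ t, g (Multiplicative.ofAdd (Finsupp.single t 1)) = f (d t)) : RootAlgebra p d →+* C :=
  Ideal.Quotient.lift _ (liftNCRingHom f g fun _ _ => Commute.all _ _) (by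
    intro a ha
    rw [← RingHom.mem_ker]
    refine Ideal.span_le.2 ?_ ha
    rintro _ ⟨t, rfl⟩
    rw [SetLike.mem_coe, RingHom.mem_ker, map_sub, liftNCRingHom_single, liftNCRingHom_single, h]
    simp)

theorem lift_base (f : B →+* C) (g : Multiplicative (T →₀ pFractions p) →* C) (h) (b : B) :
    lift p d f g h (base p d b) = f b := by
  change liftNCRingHom f g (fun _ _ => Commute.all _ _) (single 0 b) = f b
  simp

theorem lift_root (f : B →+* C) (g : Multiplicative (T →₀ pFractions p) →* C) (h) (x) :
    lift p d f g h (root p d x) = g x := by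
  change liftNCRingHom f g (fun _ _ => Commute.all _ _) (single _ 1) = g x
  simp

variable {p d} in
theorem hom_ext {f g : RootAlgebra p d →+* C} (hb : ∀ b, f (base p d b) = g (base p d b))
    (hr : ∀ x, f (root p d x) = g (root p d x)) : f = g := by
  refine RingHom.ext fun x => ?_
  classical
  induction x using RootAlgebra.induction with
  | hmul b x => rw [map_mul, map_mul, hb, hr]
  | hadd x y hx hy => rw [map_add, map_add, hx, hy]

/-- Coordinates on the monoid algebra with respect to the fractional exponents. -/
noncomputable def preCoord : AddMonoidAlgebra B (T →₀ pFractions p) →+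
    ((T →₀ pFractions p) →₀ B) :=
  (Finsupp.liftAddHom fun g => (Finsupp.singleAddHom (exponentFract g)).comp
    (AddMonoidHom.mulRight ((exponentFloor g).prod fun t n => d t ^ n))).comp
    coeffAddEquiv.toAddMonoidHom

theorem preCoord_single (g : T →₀ pFractions p) (b : B) :
    preCoord p d (single g b) = Finsupp.single (exponentFract g)
      (b * (exponentFloor g).prod fun t n => d t ^ n) :=
  Finsupp.liftAddHom_apply_single _ _ _

/-- Multiplying by the generator of index `t` raises one integral part by one and fixes the
fractional part, which the weight turns into a factor `d t`; so every multiple of a relation is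
killed. -/
theorem preCoord_eq_zero {y : AddMonoidAlgebra B (T →₀ pFractions p)}
    (hy : y ∈ Ideal.span (Set.range fun t =>
    (single (Finsupp.single t 1) 1 - single 0 (d t) : AddMonoidAlgebra B (T →₀ pFractions p)))) :
    preCoord p d y = 0 := by
  suffices ∀ s, preCoord p d (s * y) = 0 by simpa using this 1
  induction hy using Submodule.span_induction with
  | mem y hy =>
    obtain ⟨t, rfl⟩ := hy
    intro s
    induction s using AddMonoidAlgebra.induction_linear with
    | zero => simp
    | add f g hf hg => rw [add_mul, map_add, hf, hg, add_zero]
    | single g b =>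
      simp only [mul_sub, single_mul_single, map_sub, preCoord_single, add_zero, mul_one]
      rw [add_comm g, ← natExponent_single, exponentFract_natExponent_add,
        exponentFloor_natExponent_add, Finsupp.prod_add_index' (by simp) (by simp [pow_add])]
      simp [mul_assoc]
  | zero => simp
  | add x y _ _ hx hy => intro s; rw [mul_add, map_add, hx, hy, add_zero]
  | smul a x _ hx => intro s; rw [smul_eq_mul, ← mul_assoc, hx]

/-- Coordinates on the root algebra with respect to the fractional exponents. -/
noncomputable def coord (x : RootAlgebra p d) : (T →₀ pFractions p) →₀ B :=
  preCoord p d (mk_surjective p d x).choose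

theorem coord_mk (y : AddMonoidAlgebra B (T →₀ pFractions p)) :
    coord p d (mk p d y) = preCoord p d y := by
  rw [coord, ← sub_eq_zero, ← map_sub]
  exact preCoord_eq_zero p d (Ideal.Quotient.eq.1 (mk_surjective p d (mk p d y)).choose_spec)

theorem coord_add (x y : RootAlgebra p d) : coord p d (x + y) = coord p d x + coord p d y := by
  obtain ⟨x, rfl⟩ := mk_surjective p d x
  obtain ⟨y, rfl⟩ := mk_surjective p d y
  rw [← map_add, coord_mk, coord_mk, coord_mk, map_add]

theorem coord_zero : coord p d 0 = 0 := by
  simpa using coord_add p d 0 0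

theorem coord_sum {ι : Type*} (s : Finset ι) (f : ι → RootAlgebra p d) :
    coord p d (∑ i ∈ s, f i) = ∑ i ∈ s, coord p d (f i) :=
  map_sum (⟨⟨coord p d, coord_zero p d⟩, coord_add p d⟩ : RootAlgebra p d →+ _) f s

theorem coord_mul (b : B) (g : T →₀ pFractions p) :
    coord p d (base p d b * root p d (Multiplicative.ofAdd g)) =
      Finsupp.single (exponentFract g) (b * (exponentFloor g).prod fun t n => d t ^ n) := by
  rw [← mk_single, coord_mk, preCoord_single]

theorem coord_base (b : B) : coord p d (base p d b) = Finsupp.single 0 b := by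
  have := coord_mul p d b 0
  rw [ofAdd_zero, map_one, mul_one, exponentFract_zero, exponentFloor_zero] at this
  simpa using this

theorem base_injective : Function.Injective (base p d) := by
  intro a b h
  have := congrArg (coord p d) h
  rw [coord_base, coord_base] at this
  exact Finsupp.single_injective _ this

theorem coord_base_mul (b : B) (x : RootAlgebra p d) (g : T →₀ pFractions p) :
    coord p d (base p d b * x) g = b * coord p d x g := by
  classical
  induction x using RootAlgebra.induction with
  | hmul c h =>
    rw [← mul_assoc, ← map_mul, ← ofAdd_toAdd h, coord_mul, coord_mul, mul_assoc,
      Finsupp.single_apply, Finsupp.single_apply]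
    split <;> simp
  | hadd x y hx hy => rw [mul_add, coord_add, coord_add, Finsupp.add_apply, Finsupp.add_apply,
      hx, hy, mul_add]

theorem coord_fract {x : RootAlgebra p d} {g : T →₀ pFractions p} (hg : coord p d x g ≠ 0) :
    exponentFract g = g := by
  contrapose! hg
  classical
  induction x using RootAlgebra.induction with
  | hmul c h =>
    rw [← ofAdd_toAdd h, coord_mul, Finsupp.single_apply, if_neg]
    rintro rfl
    exact hg (exponentFract_fract _)
  | hadd x y hx hy => rw [coord_add, Finsupp.add_apply, hx, hy, add_zero]

theorem root_natExponent (ν : T →₀ ℕ) :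
    root p d (Multiplicative.ofAdd (natExponent p T ν)) =
      base p d (ν.prod fun t n => d t ^ n) := by
  induction ν using Finsupp.induction_linear with
  | zero => simp
  | add f g hf hg =>
    rw [map_add, ofAdd_add, map_mul, hf, hg, ← map_mul,
      Finsupp.prod_add_index' (by simp) (by simp [pow_add])]
  | single t n =>
    have h : Finsupp.single t n = n • Finsupp.single t 1 := by simp
    rw [Finsupp.prod_single_index (h := fun t n => d t ^ n) (pow_zero _), h, map_nsmul,
      natExponent_single,
      ofAdd_nsmul, map_pow, root_single_one, ← map_pow]

theorem sum_coord (x : RootAlgebra p d) :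
    ((coord p d x).sum fun g b => base p d b * root p d (Multiplicative.ofAdd g)) = x := by
  have hz : ∀ g, base p d 0 * root p d (Multiplicative.ofAdd g) = 0 := by simp
  classical
  induction x using RootAlgebra.induction with
  | hmul b g =>
    conv_rhs => rw [← ofAdd_toAdd g, ← exponentFloor_add_fract (Multiplicative.toAdd g),
      ofAdd_add, map_mul, root_natExponent, ← mul_assoc, ← map_mul]
    conv_lhs => rw [← ofAdd_toAdd g, coord_mul, Finsupp.sum_single_index (hz _)]
  | hadd x y hx hy =>
    rw [coord_add, Finsupp.sum_add_index' hz (by simp [add_mul]), hx, hy]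

/-- The roots with exponents in `[0, 1)` form a `B`-basis, so regularity and kernels can be tested
coefficientwise. -/
theorem coord_injective : Function.Injective (coord p d) := fun x y h => by
  rw [← sum_coord p d x, h, sum_coord]

theorem base_mul_eq_zero {π : B} (hπ : ∀ b, π * b = 0 → b = 0) {x : RootAlgebra p d}
    (hx : base p d π * x = 0) : x = 0 := by
  refine coord_injective p d ?_
  ext g
  rw [coord_zero]
  refine hπ _ ?_
  rw [← coord_base_mul, hx, coord_zero, Finsupp.zero_apply]

/-- Functoriality of the root algebra. -/
noncomputable def map {T' B' : Type*} [CommRing B'] (d' : T' → B') (θ : B →+* B') (ι : T → T')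
    (h : ∀ t, d' (ι t) = θ (d t)) : RootAlgebra p d →+* RootAlgebra p d' :=
  lift p d ((base p d').comp θ)
    ((root p d').comp (AddMonoidHom.toMultiplicative (Finsupp.mapDomain.addMonoidHom ι)))
    (fun t => by
      rw [RingHom.comp_apply, ← h, ← root_single_one]
      simp)

theorem map_base {T' B' : Type*} [CommRing B'] (d' : T' → B') (θ : B →+* B') (ι : T → T')
    (h : ∀ t, d' (ι t) = θ (d t)) (b : B) :
    map p d d' θ ι h (base p d b) = base p d' (θ b) :=
  lift_base p d _ _ _ b

theorem map_root {T' B' : Type*} [CommRing B'] (d' : T' → B') (θ : B →+* B') (ι : T → T')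
    (h : ∀ t, d' (ι t) = θ (d t)) (g : T →₀ pFractions p) :
    map p d d' θ ι h (root p d (Multiplicative.ofAdd g)) =
      root p d' (Multiplicative.ofAdd (g.mapDomain ι)) :=
  lift_root p d _ _ _ _

theorem coord_map {B' : Type*} [CommRing B'] (d' : T → B') (θ : B →+* B')
    (h : ∀ t, d' t = θ (d t)) (x : RootAlgebra p d) (g : T →₀ pFractions p) :
    coord p d' (map p d d' θ id h x) g = θ (coord p d x g) := by
  classical
  induction x using RootAlgebra.induction with
  | hmul b x =>
    rw [← ofAdd_toAdd x, map_mul, map_base, map_root, Finsupp.mapDomain_id, coord_mul, coord_mul,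
      Finsupp.single_apply, Finsupp.single_apply]
    split
    · simp [h, Finsupp.prod]
    · simp
  | hadd x y hx hy => simp [coord_add, hx, hy]

theorem map_surjective {B' : Type*} [CommRing B'] (d' : T → B') (θ : B →+* B')
    (h : ∀ t, d' t = θ (d t)) (hθ : Function.Surjective θ) :
    Function.Surjective (map p d d' θ id h) := by
  intro y
  induction y using RootAlgebra.induction with
  | hmul b x =>
    obtain ⟨b, rfl⟩ := hθ b
    refine ⟨base p d b * root p d x, ?_⟩
    rw [map_mul, map_base, ← ofAdd_toAdd x, map_root, Finsupp.mapDomain_id]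
  | hadd x y hx hy =>
    obtain ⟨x, rfl⟩ := hx
    obtain ⟨y, rfl⟩ := hy
    exact ⟨x + y, map_add _ _ _⟩

theorem dvd_of_map_eq_zero {B' : Type*} [CommRing B'] (d' : T → B') (θ : B →+* B')
    (h : ∀ t, d' t = θ (d t)) {π : B} (hθ : ∀ b, θ b = 0 → π ∣ b) {x : RootAlgebra p d}
    (hx : map p d d' θ id h x = 0) : base p d π ∣ x := by
  rw [← sum_coord p d x]
  refine Finset.dvd_sum fun g _ => Dvd.dvd.mul_right (map_dvd (base p d) (hθ _ ?_)) _
  rw [← coord_map p d d' θ h, hx, coord_zero, Finsupp.zero_apply]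

end RootAlgebra

end RootAlgebra

/-! ### `p`-independence and Frobenius on the root algebra -/

open AddMonoidAlgebra

/-- A family `d` in a ring of characteristic `p` is `p`-independent if its monomials with exponents
less than `p` are linearly independent over the ring of `p`-th powers. -/
def IsPIndependent (p : ℕ) {T R : Type*} [CommRing R] (d : T → R) : Prop :=
  ∀ (s : Finset (T →₀ ℕ)) (b : (T →₀ ℕ) → R), (∀ ν ∈ s, ∀ t, ν t < p) →
    ∑ ν ∈ s, b ν ^ p * ν.prod (fun t n => d t ^ n) = 0 → ∀ ν ∈ s, b ν = 0

theorem IsPIndependent.eq_zero {p : ℕ} {T R ι : Type*} [CommRing R] {d : T → R}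
    (hd : IsPIndependent p d) (s : Finset ι) (b : ι → R) (n : ι → T →₀ ℕ)
    (hinj : Set.InjOn n s) (hlt : ∀ i ∈ s, ∀ t, n i t < p)
    (h : ∑ i ∈ s, b i ^ p * (n i).prod (fun t m => d t ^ m) = 0) : ∀ i ∈ s, b i = 0 := by
  classical
  rcases s.eq_empty_or_nonempty with rfl | ⟨i₀, hi₀⟩
  · simp
  have : Nonempty ι := ⟨i₀⟩
  intro i hi
  have hinv (j : ι) (hj : j ∈ s) : Function.invFunOn n s (n j) = j :=
    hinj.leftInvOn_invFunOn hj
  have := hd (s.image n) (fun ν => b (Function.invFunOn n s ν)) (by simpa using hlt) (by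
    rw [Finset.sum_image hinj, ← h]
    exact Finset.sum_congr rfl fun j hj => by rw [hinv j hj]) (n i) (Finset.mem_image_of_mem _ hi)
  rwa [hinv i hi] at this

section Frobenius

variable (p : ℕ) [hp : Fact p.Prime] {T R : Type*} [CommRing R] (d : T → R)

namespace RootAlgebra

theorem charP [CharP R p] : CharP (RootAlgebra p d) p :=
  charP_of_injective_ringHom (base_injective p d) p

theorem coord_sum_mul {ι : Type*} (s : Finset ι) (b : ι → R) (g : ι → T →₀ pFractions p)
    (h : T →₀ pFractions p) [DecidableEq (T →₀ pFractions p)] :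
    coord p d (∑ i ∈ s, base p d (b i) * root p d (Multiplicative.ofAdd (g i))) h =
      ∑ i ∈ s with exponentFract (g i) = h,
        b i * (exponentFloor (g i)).prod fun t n => d t ^ n := by
  rw [coord_sum, Finset.sum_filter, Finsupp.finsetSum_apply]
  refine Finset.sum_congr rfl fun i _ => ?_
  rw [coord_mul, Finsupp.single_apply]

variable {d} in
-- Frobenius turns a fractional exponent `g` into `p • g`, whose integral part has entries less than
-- `p`. Among terms with the same fractional part of `p • g`, the integral parts differ, so each
-- coordinate of `x ^ p` is a sum of `p`-th powers times distinct small monomials in `d`, to which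
-- `p`-independence applies.
theorem eq_zero_of_pow_eq_zero [CharP R p] (hd : IsPIndependent p d) {x : RootAlgebra p d}
    (hx : x ^ p = 0) : x = 0 := by
  classical
  have := charP p d
  by_contra hne
  have hne' : coord p d x ≠ 0 := fun h => hne (coord_injective p d (h.trans (coord_zero p d).symm))
  obtain ⟨φ, hφ⟩ := Finsupp.support_nonempty_iff.2 hne'
  have hxp : x ^ p = ∑ g ∈ (coord p d x).support,
      base p d (coord p d x g ^ p) * root p d (Multiplicative.ofAdd (p • g)) := by
    conv_lhs => rw [← sum_coord p d x, Finsupp.sum, sum_pow_char]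
    refine Finset.sum_congr rfl fun g _ => ?_
    rw [mul_pow, ← map_pow (base p d), ← map_pow (root p d), ofAdd_nsmul]
  have h0 := coord_sum_mul p d (coord p d x).support (fun g => coord p d x g ^ p)
    (fun g => p • g) (exponentFract (p • φ))
  rw [← hxp, hx, coord_zero, Finsupp.zero_apply] at h0
  refine Finsupp.mem_support_iff.1 hφ (hd.eq_zero _ _ (fun g => exponentFloor (p • g)) ?_ ?_
    h0.symm φ (Finset.mem_filter.2 ⟨hφ, rfl⟩))
  · intro g hg h hh hgh
    simp only [Finset.coe_filter, Set.mem_ofPred_eq] at hg hh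
    refine nsmul_finsupp_pFractions_injective (p := p) ?_
    rw [← exponentFloor_add_fract (p • g), ← exponentFloor_add_fract (p • h), hg.2, hh.2]
    congr 2
  · intro g hg t
    refine exponentFloor_nsmul_lt (coord_fract p d (x := x) ?_) t
    exact Finsupp.mem_support_iff.1 (Finset.mem_filter.1 hg).1

/-- The root algebra is purely inseparable over its base. Being reduced as well, it inherits the
domain property, and injectivity of maps out of it is decided on the base. -/
theorem exists_pow_eq_base [CharP R p] (x : RootAlgebra p d) :
    ∃ (n : ℕ) (r : R), x ^ p ^ n = base p d r := by
  have := charP p d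
  induction x using RootAlgebra.induction with
  | hmul b g =>
    obtain ⟨n, ν, h⟩ := exists_pow_nsmul_eq_natExponent (Multiplicative.toAdd g)
    refine ⟨n, b ^ p ^ n * ν.prod fun t m => d t ^ m, ?_⟩
    rw [mul_pow, ← map_pow, ← map_pow, map_mul, ← root_natExponent, ← h, ofAdd_nsmul, ofAdd_toAdd]
  | hadd x y hx hy =>
    obtain ⟨n, r, h⟩ := hx
    obtain ⟨n', r', h'⟩ := hy
    refine ⟨n + n', r ^ p ^ n' + r' ^ p ^ n, ?_⟩
    rw [add_pow_char_pow, pow_add, pow_mul, h, mul_comm, pow_mul, h', map_add, map_pow, map_pow]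

variable {d} in
theorem isReduced [CharP R p] (hd : IsPIndependent p d) (x : RootAlgebra p d) (n : ℕ)
    (hx : x ^ p ^ n = 0) : x = 0 := by
  induction n with
  | zero => simpa using hx
  | succ n ih =>
    rw [pow_succ, pow_mul] at hx
    exact ih (eq_zero_of_pow_eq_zero p hd hx)

variable {d} in
theorem isDomain [CharP R p] [IsDomain R] (hd : IsPIndependent p d) :
    IsDomain (RootAlgebra p d) := by
  have : Nontrivial (RootAlgebra p d) := (base_injective p d).nontrivial
  have : NoZeroDivisors (RootAlgebra p d) := by
    refine ⟨fun {x y} hxy => ?_⟩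
    obtain ⟨n, r, h⟩ := exists_pow_eq_base p d x
    obtain ⟨m, s, h'⟩ := exists_pow_eq_base p d y
    have h1 : base p d (r ^ p ^ m * s ^ p ^ n) = base p d 0 := by
      rw [map_mul, map_pow, map_pow, ← h, ← h', ← pow_mul, ← pow_mul, mul_comm (p ^ m), ← mul_pow,
        hxy, zero_pow (by simp [hp.out.ne_zero]), map_zero]
    rcases mul_eq_zero.1 (base_injective p d h1) with h2 | h2
    · left
      rw [pow_eq_zero_iff (pow_ne_zero _ hp.out.ne_zero)] at h2
      exact isReduced p hd x n (by rw [h, h2, map_zero])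
    · right
      rw [pow_eq_zero_iff (pow_ne_zero _ hp.out.ne_zero)] at h2
      exact isReduced p hd y m (by rw [h', h2, map_zero])
  exact NoZeroDivisors.to_isDomain _

variable {d} in
theorem injective_of_injective_base [CharP R p] (hd : IsPIndependent p d) {S : Type*} [CommRing S]
    (f : RootAlgebra p d →+* S) (hf : Function.Injective (f.comp (base p d))) :
    Function.Injective f := by
  rw [injective_iff_map_eq_zero]
  intro x hx
  obtain ⟨n, r, h⟩ := exists_pow_eq_base p d x
  refine isReduced p hd x n ?_
  have : f.comp (base p d) r = f.comp (base p d) 0 := by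
    rw [RingHom.comp_apply, ← h, map_pow, hx, zero_pow (pow_ne_zero _ hp.out.ne_zero), map_zero]
  rw [h, hf this, map_zero]

/-- Roots already have `p`-th roots and Frobenius is additive, so only constants need checking. -/
theorem exists_pow_eq [CharP R p] (h : ∀ r, ∃ x : RootAlgebra p d, x ^ p = base p d r)
    (y : RootAlgebra p d) : ∃ x, x ^ p = y := by
  have := charP p d
  induction y using RootAlgebra.induction with
  | hmul b g =>
    obtain ⟨x, hx⟩ := h b
    obtain ⟨g', hg'⟩ := exists_nsmul_finsupp_eq (p := p) (Multiplicative.toAdd g)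
    refine ⟨x * root p d (Multiplicative.ofAdd g'), ?_⟩
    rw [mul_pow, hx, ← map_pow, ← ofAdd_nsmul, hg', ofAdd_toAdd]
  | hadd x y hx hy =>
    obtain ⟨x, rfl⟩ := hx
    obtain ⟨y, rfl⟩ := hy
    exact ⟨x + y, add_pow_char _ _ _⟩

end RootAlgebra

end Frobenius

/-! ### `p`-independence after adjoining perfect variables -/

section MonoidAlgebra

variable {p : ℕ} [hp : Fact p.Prime] {T k : Type*} [CommRing k] [CharP k p] {J : Type*}

instance : CharP (AddMonoidAlgebra k (J →₀ pFractions p)) p :=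
  charP_of_injective_ringHom (f := singleZeroRingHom)
    (AddMonoidAlgebra.single_right_injective (m := 0)) p

theorem coeff_pow_char (x : AddMonoidAlgebra k (J →₀ pFractions p)) (g : J →₀ pFractions p) :
    (x ^ p).coeff (p • g) = x.coeff g ^ p := by
  classical
  induction x using AddMonoidAlgebra.induction_linear with
  | zero => simp [hp.out.ne_zero]
  | add x y hx hy => simp [add_pow_char, hx, hy]
  | single h b =>
    rw [single_pow, coeff_single, coeff_single, Finsupp.single_apply, Finsupp.single_apply]
    by_cases hgh : h = g
    · simp [hgh]
    · rw [if_neg hgh, if_neg fun h => hgh (nsmul_finsupp_pFractions_injective h),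
        zero_pow hp.out.ne_zero]

/-- Frobenius is injective on exponents, so the coefficient of a relation at `p • g` is a relation
over `k` among the coefficients at `g`. -/
theorem IsPIndependent.addMonoidAlgebra {d : T → k} (hd : IsPIndependent p d) (J : Type*) :
    IsPIndependent p
      (fun t => (single 0 (d t) : AddMonoidAlgebra k (J →₀ pFractions p))) := by
  intro s b hs h ν hν
  ext g
  refine hd s (fun ν => (b ν).coeff g) hs ?_ ν hν
  have hmon (ν : T →₀ ℕ) : (ν.prod fun t n =>
      (single 0 (d t) : AddMonoidAlgebra k (J →₀ pFractions p)) ^ n) =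
      single 0 (ν.prod fun t n => d t ^ n) := by
    simp [Finsupp.prod]
  have := congrArg (fun y : AddMonoidAlgebra k (J →₀ pFractions p) => y.coeff (p • g)) h
  simpa [hmon, coeff_mul_single_zero, coeff_pow_char] using this

end MonoidAlgebra

/-! ### Existence of `p`-bases -/

section PBasis

theorem isPIndependent_of_isEmpty {p : ℕ} [hp : Fact p.Prime] {k T : Type*} [Field k]
    [IsEmpty T] (d : T → k) : IsPIndependent p d := by
  intro s b _ h ν hν
  have hs : s = {ν} := Finset.eq_singleton_iff_unique_mem.2 ⟨hν, fun _ _ => Subsingleton.elim _ _⟩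
  rw [hs, Finset.sum_singleton, Subsingleton.elim ν 0, Finsupp.prod_zero_index, mul_one,
    pow_eq_zero_iff hp.out.ne_zero] at h
  rw [Subsingleton.elim ν 0, h]

variable {p : ℕ} [hp : Fact p.Prime] {k : Type*} [Field k] [CharP k p] {ι T : Type*}

/-- The monomial in the values of `v` with exponent vector `ν`. -/
def familyMonomial (v : ι → k) (ν : ι →₀ ℕ) : k := ν.prod fun i n => v i ^ n

theorem isPIndependent_iff_linearIndependent {d : T → k} :
    IsPIndependent p d ↔ LinearIndependent (frobenius k p).fieldRange
      (fun ν : {ν : T →₀ ℕ // ∀ t, ν t < p} => familyMonomial d ν) := by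
  classical
  rw [linearIndependent_iff']
  constructor
  · intro h s g hg i hi
    choose b hb using fun i => (g i).2
    have := h.eq_zero s b (fun i => (i : T →₀ ℕ)) Subtype.val_injective.injOn
      (fun i _ => i.2) (by
        rw [← hg]
        refine Finset.sum_congr rfl fun i _ => ?_
        rw [Subfield.smul_def, smul_eq_mul, ← hb]
        rfl) i hi
    apply Subtype.ext
    rw [← hb, this, map_zero]
    rfl
  · intro h s b hs hb ν hν
    have := h (s.subtype _) (fun ν => ⟨b ν ^ p, b ν, rfl⟩) (by
      rw [← hb, ← Finset.sum_subtype_of_mem (p := fun ν : T →₀ ℕ => ∀ t, ν t < p)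
        (fun ν => b ν ^ p * ν.prod fun t n => d t ^ n) hs]
      rfl) ⟨ν, hs ν hν⟩ (by simpa using hν)
    exact (pow_eq_zero_iff hp.out.ne_zero).1 (congrArg Subtype.val this)

/-- The exponent vectors supported in `s` with entries less than `p`. -/
def smallExponents (p : ℕ) (s : Set ι) : Set (ι →₀ ℕ) :=
  {ν | ↑ν.support ⊆ s ∧ ∀ i, ν i < p}

/-- The members of the family `v` with index in `s` are `p`-independent. -/
def IsPIndependentOn (p : ℕ) [Fact p.Prime] [CharP k p] (v : ι → k) (s : Set ι) : Prop :=
  LinearIndepOn (frobenius k p).fieldRange (familyMonomial v) (smallExponents p s)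

theorem exists_equiv_smallExponents {f : T → ι} (hf : Function.Injective f) :
    ∃ e : {ν : T →₀ ℕ // ∀ t, ν t < p} ≃ smallExponents p (Set.range f),
      ∀ ν, (e ν : ι →₀ ℕ) = ν.1.embDomain ⟨f, hf⟩ := by
  have hmem (ν : {ν : T →₀ ℕ // ∀ t, ν t < p}) :
      ν.1.embDomain ⟨f, hf⟩ ∈ smallExponents p (Set.range f) := by
    refine ⟨by simp [Finsupp.support_embDomain], fun i => ?_⟩
    by_cases hi : i ∈ Set.range f
    · obtain ⟨t, rfl⟩ := hi
      exact lt_of_eq_of_lt (Finsupp.embDomain_apply_self ⟨f, hf⟩ ν.1 t) (ν.2 t)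
    · rw [Finsupp.embDomain_of_notMem_range _ _ _ (by simpa using hi)]
      exact hp.out.pos
  refine ⟨Equiv.ofBijective (fun ν => ⟨_, hmem ν⟩) ⟨?_, ?_⟩, fun ν => rfl⟩
  · intro ν ν' h
    exact Subtype.ext (Finsupp.embDomain_injective _ (congrArg Subtype.val h))
  · rintro ⟨ν, hν, hlt⟩
    exact ⟨⟨ν.comapDomain f hf.injOn, fun t => hlt (f t)⟩,
      Subtype.ext (Finsupp.embDomain_comapDomain (f := ⟨f, hf⟩) hν)⟩

theorem isPIndependentOn_range_iff {v : ι → k} {f : T → ι} (hf : Function.Injective f) :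
    IsPIndependentOn p v (Set.range f) ↔ IsPIndependent p (v ∘ f) := by
  obtain ⟨e, he⟩ := exists_equiv_smallExponents (p := p) hf
  have hmon : (fun ν : {ν : T →₀ ℕ // ∀ t, ν t < p} => familyMonomial (v ∘ f) ν) =
      (fun ν : smallExponents p (Set.range f) => familyMonomial v ν) ∘ e := by
    ext ν
    rw [Function.comp_apply, he, familyMonomial, familyMonomial, Finsupp.prod_embDomain]
    rfl
  rw [isPIndependent_iff_linearIndependent, hmon, linearIndependent_equiv]
  exact Iff.rfl

/-- A monomial has finite support, so it already lives on one member of the chain. -/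
theorem isPIndependentOn_sUnion {v : ι → k} {c : Set (Set ι)} (hc : IsChain (· ⊆ ·) c)
    (hne : c.Nonempty) (h : ∀ s ∈ c, IsPIndependentOn p v s) : IsPIndependentOn p v (⋃₀ c) := by
  have : smallExponents p (⋃₀ c) = ⋃₀ (smallExponents p '' c) := by
    ext ν
    simp only [Set.sUnion_image, Set.mem_iUnion, exists_prop]
    constructor
    · rintro ⟨h1, h2⟩
      obtain ⟨s, hs, hs'⟩ := DirectedOn.exists_mem_subset_of_finite_of_subset_sUnion hne
        hc.directedOn ν.support.finite_toSet h1
      exact ⟨s, hs, hs', h2⟩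
    · rintro ⟨s, hs, h1, h2⟩
      exact ⟨h1.trans (Set.subset_sUnion_of_mem hs), h2⟩
  rw [IsPIndependentOn, this]
  refine linearIndepOn_sUnion_of_directed ?_ ?_
  · rintro _ ⟨s, hs, rfl⟩ _ ⟨t, ht, rfl⟩
    obtain ⟨r, hr, h1, h2⟩ := hc.directedOn s hs t ht
    exact ⟨_, ⟨r, hr, rfl⟩, fun ν hν => ⟨hν.1.trans h1, hν.2⟩, fun ν hν => ⟨hν.1.trans h2, hν.2⟩⟩
  · rintro _ ⟨s, hs, rfl⟩
    exact h s hs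

/-- Since `a ^ p` lies in `K` but its only `p`-th root `a` does not, `X ^ p - a ^ p` is irreducible
and is the minimal polynomial of `a`. -/
theorem linearIndependent_pow_of_notMem (K : IntermediateField (frobenius k p).fieldRange k)
    {a : k} (ha : a ∉ K) : LinearIndependent K fun i : Fin p => a ^ (i : ℕ) := by
  have hap : a ^ p ∈ K := K.algebraMap_mem ⟨a ^ p, a, rfl⟩
  have hirr : Irreducible (Polynomial.X ^ p - Polynomial.C (⟨a ^ p, hap⟩ : K)) := by
    refine X_pow_sub_C_irreducible_of_prime hp.out fun b hb => ha ?_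
    have : (b : k) ^ p = a ^ p := congrArg Subtype.val hb
    rw [← frobenius_inj k p this]
    exact b.2
  have hmin := minpoly.eq_of_irreducible_of_monic (x := a) hirr (by simp)
    (Polynomial.monic_X_pow_sub_C _ hp.out.ne_zero)
  have hdeg : (minpoly K a).natDegree = p := by rw [← hmin, Polynomial.natDegree_X_pow_sub_C]
  have := linearIndependent_pow (K := K) a
  rw [hdeg] at this
  exact this

/-- Tower argument: monomials on `s` are independent over the `p`-th powers and lie in `K`, powers
of `v a` are independent over `K`, and products of the two remain independent. -/
theorem IsPIndependentOn.insert {v : ι → k} {s : Set ι} (hs : IsPIndependentOn p v s) {a : ι}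
    (ha : v a ∉ IntermediateField.adjoin (frobenius k p).fieldRange (v '' s)) :
    IsPIndependentOn p v (insert a s) := by
  classical
  set K := IntermediateField.adjoin (frobenius k p).fieldRange (v '' s) with hK
  have has : a ∉ s := fun h => ha (IntermediateField.subset_adjoin _ _ ⟨a, h, rfl⟩)
  have hmem (ν : smallExponents p s) : familyMonomial v ν ∈ K :=
    prod_mem fun i hi => pow_mem
      (IntermediateField.subset_adjoin _ _ (Set.mem_image_of_mem v (ν.2.1 hi))) _
  have h1 : LinearIndependent (frobenius k p).fieldRange
      (fun ν : smallExponents p s => (⟨familyMonomial v ν, hmem ν⟩ : K)) :=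
    LinearIndependent.of_comp K.val.toLinearMap hs
  have h2 := linearIndependent_smul h1 (linearIndependent_pow_of_notMem K ha)
  -- Splits off the exponent of `a`, matching each monomial with one of the products.
  let e : smallExponents p (Insert.insert a s) → smallExponents p s × Fin p := fun ν =>
    (⟨ν.1.erase a, by
      refine ⟨fun i hi => ?_, fun i => ?_⟩
      · rw [Finsupp.support_erase, Finset.coe_erase] at hi
        exact (ν.2.1 hi.1).resolve_left hi.2
      · by_cases hi : i = a
        · simp [hi, hp.out.pos]
        · simpa [hi] using ν.2.2 i⟩, ⟨ν.1 a, ν.2.2 a⟩)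
  have he : Function.Injective e := by
    intro ν ν' h
    simp only [e, Prod.mk.injEq, Fin.mk.injEq] at h
    apply Subtype.ext
    ext i
    by_cases hi : i = a
    · rw [hi, h.2]
    · have := DFunLike.congr_fun (congrArg Subtype.val h.1) i
      simpa [hi] using this
  have h3 := h2.comp e he
  rw [IsPIndependentOn, LinearIndepOn]
  convert h3 using 1
  ext ν
  simp only [Function.comp_apply, e, IntermediateField.smul_def, smul_eq_mul, familyMonomial]
  rw [mul_comm, Finsupp.mul_prod_erase' (ν : ι →₀ ℕ) a (fun i n => v i ^ n) (by simp)]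

theorem exists_isPIndependentOn_adjoin_eq_top {v : ι → k} (hv : Function.Surjective v) {s₀ : Set ι}
    (hs₀ : IsPIndependentOn p v s₀) : ∃ s, s₀ ⊆ s ∧ IsPIndependentOn p v s ∧
      IntermediateField.adjoin (frobenius k p).fieldRange (v '' s) = ⊤ := by
  obtain ⟨s, hs₀s, hs⟩ := zorn_subset_nonempty {s | IsPIndependentOn p v s}
    (fun c hc hchain hne => ⟨⋃₀ c, isPIndependentOn_sUnion hchain hne hc,
      fun t ht => Set.subset_sUnion_of_mem ht⟩) s₀ hs₀
  refine ⟨s, hs₀s, hs.prop, ?_⟩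
  rw [eq_top_iff]
  intro x _
  obtain ⟨a, rfl⟩ := hv x
  by_contra ha
  have := hs.le_of_ge (IsPIndependentOn.insert hs.prop ha) (Set.subset_insert a s)
  exact ha (IntermediateField.subset_adjoin _ _ ⟨a, this (Set.mem_insert a s), rfl⟩)

/-- If `T` generates `k` over the field of `p`-th powers then any subring containing these
generators and the `p`-th powers is everything. -/
theorem mem_of_adjoin_eq_top {d : T → k}
    (hd : IntermediateField.adjoin (frobenius k p).fieldRange (Set.range d) = ⊤)
    (R : Subring k) (hR : ∀ x, x ^ p ∈ R) (hdR : ∀ t, d t ∈ R) (x : k) : x ∈ R := by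
  let K : Subfield k := { R with
    inv_mem' := fun x hx => by
      rcases eq_or_ne x 0 with rfl | h0
      · simp
      -- A subring containing all `p`-th powers is closed under inverses, so generation as a field
      -- reduces to generation as a ring.
      · have : x⁻¹ = (x⁻¹) ^ p * x ^ (p - 1) := by
          obtain ⟨n, hn⟩ := Nat.exists_eq_succ_of_ne_zero hp.out.ne_zero
          rw [hn, Nat.succ_eq_add_one, Nat.add_sub_cancel, pow_succ', mul_assoc, ← mul_pow,
            inv_mul_cancel₀ h0, one_pow, mul_one]
        change x⁻¹ ∈ R
        rw [this]
        exact mul_mem (hR _) (pow_mem hx _) }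
  let K' : IntermediateField (frobenius k p).fieldRange k :=
    K.toIntermediateField (by rintro ⟨_, y, rfl⟩; exact hR y)
  have : IntermediateField.adjoin (frobenius k p).fieldRange (Set.range d) ≤ K' := by
    rw [IntermediateField.adjoin_le_iff]
    rintro _ ⟨t, rfl⟩
    exact hdR t
  rw [hd] at this
  exact this (show x ∈ ⊤ from trivial)

end PBasis

/-! ### MacLane's criterion: separability preserves `p`-independence -/

section MacLane

variable {p : ℕ} [hp : Fact p.Prime] {k l : Type u} [Field k] [Field l] [Algebra k l] [CharP k p]
  {T : Type*}

theorem sum_tmul_eq_zero_of_linearIndependent {R M N ι : Type*} [Field R] [AddCommGroup M]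
    [Module R M] [AddCommGroup N] [Module R N] (s : Finset ι) (b : ι → M) (c : ι → N)
    (hb : LinearIndepOn R b s) (h : ∑ i ∈ s, b i ⊗ₜ[R] c i = 0) : ∀ i ∈ s, c i = 0 := by
  classical
  intro i hi
  obtain ⟨g, hg⟩ := LinearMap.exists_leftInverse_of_injective
    (Finsupp.linearCombination R fun i : (s : Set ι) => b i)
    (LinearMap.ker_eq_bot.2 hb)
  have hgb (j : (s : Set ι)) : g (b j) = Finsupp.single j 1 := by
    have := LinearMap.congr_fun hg (Finsupp.single j 1)
    simpa using this
  have := congrArg (TensorProduct.lid R N ∘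
    LinearMap.rTensor N ((Finsupp.lapply (⟨i, hi⟩ : (s : Set ι))).comp g)) h
  simp only [Function.comp_apply, map_sum, LinearMap.rTensor_tmul, TensorProduct.lid_tmul,
    map_zero, LinearMap.comp_apply] at this
  rw [← this, Finset.sum_eq_single_of_mem i hi]
  · rw [hgb ⟨i, hi⟩]
    simp
  · intro j hj hji
    rw [hgb ⟨j, hj⟩, Finsupp.lapply_apply, Finsupp.single_apply, if_neg, zero_smul]
    exact fun h => hji (congrArg Subtype.val h)

/-- Let `b ν` be the `p`-th root of the monomial `d ^ ν` in the perfect closure. Independence of `d`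
makes the `b ν` linearly independent over `k`. A relation with coefficients `c ν ^ p` in `l` says
that the `p`-th power of `∑ b ν ⊗ c ν` vanishes; reducedness kills the sum, and independence kills
each `c ν`. -/
theorem IsPIndependent.algebraMap_of_isSeparable {d : T → k} (hd : IsPIndependent p d)
    (hsep : IsSeparableFieldExtension k l) :
    IsPIndependent p (fun t => algebraMap k l (d t)) := by
  intro s c hs h
  let := (PerfectClosure.of k p).toAlgebra
  have := hsep (PerfectClosure k p)
  have hchar : CharP (PerfectClosure k p ⊗[k] l) p :=
    charP_of_injective_algebraMap (FaithfulSMul.algebraMap_injective k _) p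
  choose b hb using fun ν : T →₀ ℕ => (PerfectRing.bijective_frobenius (p := p)
    (R := PerfectClosure k p)).surjective (algebraMap k _ (familyMonomial d ν))
  refine sum_tmul_eq_zero_of_linearIndependent (R := k) s b c ?_ ?_
  · rw [linearIndepOn_finset_iff]
    intro a ha ν hν
    refine hd s a hs ?_ ν hν
    refine (algebraMap k (PerfectClosure k p)).injective ?_
    rw [map_zero, ← zero_pow (M₀ := PerfectClosure k p) hp.out.ne_zero, ← ha, sum_pow_char, map_sum]
    refine Finset.sum_congr rfl fun ν _ => ?_
    rw [Algebra.smul_def, mul_pow, ← map_pow, map_mul]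
    exact congrArg _ (hb ν).symm
  · refine IsNilpotent.eq_zero (⟨p, ?_⟩ : IsNilpotent _)
    rw [sum_pow_char]
    have : ∀ ν ∈ s, (b ν ⊗ₜ[k] c ν) ^ p = (1 : PerfectClosure k p) ⊗ₜ[k]
        (c ν ^ p * ν.prod fun t n => algebraMap k l (d t) ^ n) := by
      intro ν _
      have hν : b ν ^ p = algebraMap k _ (familyMonomial d ν) := hb ν
      rw [Algebra.TensorProduct.tmul_pow, hν, Algebra.algebraMap_eq_smul_one,
        TensorProduct.smul_tmul, Algebra.smul_def, mul_comm]
      congr 2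
      exact (map_finsuppProd (algebraMap k l) ν _).trans (by simp)
    rw [Finset.sum_congr rfl this, ← TensorProduct.tmul_sum, h, TensorProduct.tmul_zero]

end MacLane

/-! ### Reductions of completions and of monoid algebras -/

theorem IsAdicDense.exists_reduction {R G S : Type*} [CommRing R] [CommRing G] [CommRing S]
    {h : R →+* G} {ϖ : R} (H : IsAdicDense h ϖ) (ψ : R →+* S) (hψ : ψ ϖ = 0)
    (hsurj : Function.Surjective ψ) (hker : ∀ r, ψ r = 0 → ϖ ∣ r) :
    ∃ Ψ : G →+* S, Ψ.comp h = ψ ∧ Function.Surjective Ψ ∧ ∀ g, Ψ g = 0 → h ϖ ∣ g := by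
  -- Because `ψ ϖ = 0`, the target is complete for the zero ideal.
  obtain ⟨Ψ, hΨ⟩ := H.exists_lift ψ (by
    rw [hψ, Ideal.span_singleton_eq_bot.2 rfl]
    infer_instance)
  subst hΨ
  refine ⟨Ψ, rfl, Function.Surjective.of_comp (g := h) hsurj, fun g hg => ?_⟩
  obtain ⟨r, s, hs⟩ := H.surj g
  have hr : Ψ.comp h r = 0 := by
    have := congrArg Ψ hs
    rw [map_sub, hg, map_mul] at this
    rw [RingHom.comp_apply] at hψ ⊢
    rw [hψ, zero_mul, zero_sub, neg_eq_zero] at this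
    exact this
  rw [sub_eq_iff_eq_add.1 hs]
  exact dvd_add (dvd_mul_right _ _) (map_dvd h (hker r hr))

section MonoidAlgebraReduction

variable {A k G : Type*} [CommRing A] [CommRing k] [AddMonoid G] {ϖ : A}

theorem single_zero_mul_eq_zero (hϖ : ∀ a, ϖ * a = 0 → a = 0) {y : AddMonoidAlgebra A G}
    (hy : single 0 ϖ * y = 0) : y = 0 := by
  ext g
  refine hϖ _ ?_
  rw [← coeff_single_zero_mul, hy, coeff_zero, Finsupp.zero_apply]

theorem single_zero_dvd_of_map_eq_zero {θ : A →+* k} (hker : ∀ a, θ a = 0 → ϖ ∣ a)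
    {y : AddMonoidAlgebra A G} (hy : mapRingHom G θ y = 0) : single 0 ϖ ∣ y := by
  choose f hf using fun g => hker (y.coeff g) (by rw [← coeff_mapRingHom, hy]; rfl)
  rw [← sum_coeff_single y]
  refine Finset.dvd_sum fun g _ => ⟨single g (f g), ?_⟩
  rw [hf g, single_mul_single, zero_add]

end MonoidAlgebraReduction

/-! ### The explicit model of the universal residual perfection -/

section Model

variable (p : ℕ) [hp : Fact p.Prime] {A k T : Type u} [CommRing A] [Field k]

/-- The reduction of the universal residual perfection: the perfect polynomial ring over `k` on
`T × ℕ` with all `p`-power roots of the `d t` adjoined. -/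
abbrev ModelReduction (d : T → k) : Type u :=
  RootAlgebra p (fun t => (single 0 (d t) : AddMonoidAlgebra k (T × ℕ →₀ pFractions p)))

/-- A ring `W` over `A` in which every `x t` has a universal expansion
`c t + ∑ a (t, j) * ϖ ^ (j + 1)`, where `c t` and `a (t, j)` have compatible `p`-power roots. -/
structure PerfectionModel (ϖ : A) (θ : A →+* k) (x : T → A) (W : Type u) [CommRing W] where
  str : A →+* W
  coef : Multiplicative (T × ℕ →₀ pFractions p) →* W
  lead : Multiplicative (T →₀ pFractions p) →* W
  red : W →+* ModelReduction p (fun t => θ (x t))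
  complete : IsAdicComplete (Ideal.span {str ϖ}) W
  regular : ∀ w, str ϖ * w = 0 → w = 0
  red_surjective : Function.Surjective red
  dvd_of_red_eq_zero : ∀ w, red w = 0 → str ϖ ∣ w
  red_str : ∀ a, red (str a) = RootAlgebra.base p _ (single 0 (θ a))
  red_coef : ∀ g, red (coef (Multiplicative.ofAdd g)) = RootAlgebra.base p _ (single g 1)
  expansion : ∀ t n, str ϖ ^ n ∣ str (x t) - lead (Multiplicative.ofAdd (Finsupp.single t 1)) -
    str ϖ * ∑ j ∈ Finset.range n, coef (Multiplicative.ofAdd (Finsupp.single (t, j) 1)) * str ϖ ^ j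
  exists_lift : ∀ (C : Type u) [CommRing C] (ψ : A →+* C)
    (α : Multiplicative (T × ℕ →₀ pFractions p) →* C)
    (γ : Multiplicative (T →₀ pFractions p) →* C),
    IsAdicComplete (Ideal.span {ψ ϖ}) C →
    (∀ t n, ψ ϖ ^ n ∣ ψ (x t) - γ (Multiplicative.ofAdd (Finsupp.single t 1)) -
      ψ ϖ * ∑ j ∈ Finset.range n, α (Multiplicative.ofAdd (Finsupp.single (t, j) 1)) * ψ ϖ ^ j) →
    ∃ F : W →+* C, F.comp str = ψ ∧ (∀ g, F (coef g) = α g) ∧ ∀ g, F (lead g) = γ g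
  hom_ext : ∀ (C : Type u) [CommRing C] (F G : W →+* C),
    IsAdicComplete (Ideal.span {F (str ϖ)}) C → F.comp str = G.comp str →
    (∀ g, F (coef g) = G (coef g)) → (∀ g, F (lead g) = G (lead g)) → F = G

theorem exists_perfectionModel (ϖ : A) (hϖ : ∀ a, ϖ * a = 0 → a = 0) (θ : A →+* k)
    (hθ : Function.Surjective θ) (hker : ∀ a, θ a = 0 ↔ ϖ ∣ a) (x : T → A) :
    ∃ (W : Type u) (_ : CommRing W), Nonempty (PerfectionModel p ϖ θ x W) := by
  have hθϖ : θ ϖ = 0 := (hker ϖ).2 dvd_rfl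
  obtain ⟨B, _, h₁, H₁, hB⟩ := exists_adicCompletion
    (AddMonoidAlgebra A (T × ℕ →₀ pFractions p)) (single 0 ϖ) fun y => single_zero_mul_eq_zero hϖ
  obtain ⟨Θ, hΘ, hΘs, hΘk⟩ := H₁.exists_reduction (mapRingHom (T × ℕ →₀ pFractions p) θ)
    (by rw [mapRingHom_single, hθϖ, single_zero])
    (AddMonoidAlgebra.map_surjective (θ : A →+ k) hθ)
    (fun y => single_zero_dvd_of_map_eq_zero fun a => (hker a).1)
  -- The tail `z t = ∑ a (t, j) * ϖ ^ j` converges because the variables have been completed.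
  have hz (t : T) : ∃ z : B, ∀ n, h₁ (single 0 ϖ) ^ n ∣ z -
      ∑ j ∈ Finset.range n, h₁ (single (Finsupp.single (t, j) 1) 1) * h₁ (single 0 ϖ) ^ j :=
    exists_limit_of_pow_dvd hB fun n => by
      rw [Finset.sum_range_succ_sub_sum]
      exact dvd_mul_left _ _
  choose z hz using hz
  -- The leading digit forced by the free digits; adjoining its `p`-power roots is all that remains.
  let d : T → B := fun t => h₁ (single 0 (x t)) - h₁ (single 0 ϖ) * z t
  obtain ⟨W, _, h₂, H₂, hW⟩ := exists_adicCompletion (RootAlgebra p d)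
    (RootAlgebra.base p d (h₁ (single 0 ϖ))) fun y hy =>
      RootAlgebra.base_mul_eq_zero p d H₁.regular hy
  have hΘh (y) : Θ (h₁ y) = mapRingHom (T × ℕ →₀ pFractions p) θ y :=
    congrArg (fun φ : AddMonoidAlgebra A (T × ℕ →₀ pFractions p) →+* _ => φ y) hΘ
  have hΘι (a : A) : Θ (h₁ (single 0 a)) = single 0 (θ a) := by
    rw [hΘh]
    exact mapRingHom_single θ 0 a
  -- The tail dies modulo `ϖ`, so the reduction adjoins roots of the constants `θ (x t)`.
  have hd (t : T) : single 0 (θ (x t)) = Θ (d t) := by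
    rw [map_sub, map_mul, hΘι, hΘι, hθϖ, single_zero, zero_mul, sub_zero]
  obtain ⟨red, hred, hreds, hredk⟩ := H₂.exists_reduction
    (RootAlgebra.map p d (fun t => single 0 (θ (x t))) Θ id hd)
    (by rw [RootAlgebra.map_base, hΘι, hθϖ, single_zero, map_zero])
    (RootAlgebra.map_surjective p d _ Θ hd hΘs)
    (fun y hy => RootAlgebra.dvd_of_map_eq_zero p d _ Θ hd hΘk hy)
  have hredh (y) : red (h₂ y) = RootAlgebra.map p d (fun t => single 0 (θ (x t))) Θ id hd y :=
    congrArg (fun φ : RootAlgebra p d →+* _ => φ y) hred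
  let str : A →+* W := h₂.comp ((RootAlgebra.base p d).comp (h₁.comp singleZeroRingHom))
  let coef : Multiplicative (T × ℕ →₀ pFractions p) →* W :=
    ((h₂.comp ((RootAlgebra.base p d).comp h₁) : _ →+* W) : _ →* W).comp
      (AddMonoidAlgebra.of A (T × ℕ →₀ pFractions p))
  let lead : Multiplicative (T →₀ pFractions p) →* W :=
    (h₂ : RootAlgebra p d →* W).comp (RootAlgebra.root p d)
  have hstr (a) : str a = h₂ (RootAlgebra.base p d (h₁ (single 0 a))) := rfl
  have hcoef (g) : coef (Multiplicative.ofAdd g) =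
    h₂ (RootAlgebra.base p d (h₁ (single g 1))) := rfl
  refine ⟨W, inferInstance, ⟨{
    str := str
    coef := coef
    lead := lead
    red := red
    complete := hW
    regular := H₂.regular
    red_surjective := hreds
    dvd_of_red_eq_zero := hredk
    red_str := fun a => ?_
    red_coef := fun g => ?_
    expansion := fun t n => ?_
    exists_lift := fun C _ ψ α γ hC h => ?_
    hom_ext := fun C _ F G hC hFG hcoe hlead => ?_ }⟩⟩
  · rw [hstr, hredh, RootAlgebra.map_base, hΘι]
  · rw [hcoef, hredh, RootAlgebra.map_base, hΘh, mapRingHom_single, map_one]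
  · have h1 : str (x t) - lead (Multiplicative.ofAdd (Finsupp.single t 1)) =
        str ϖ * h₂ (RootAlgebra.base p d (z t)) := by
      change h₂ (RootAlgebra.base p d _) - h₂ (RootAlgebra.root p d _) =
        h₂ (RootAlgebra.base p d _) * _
      rw [RootAlgebra.root_single_one, ← map_sub, ← map_sub, ← map_mul, ← map_mul]
      simp [d]
    rw [h1, ← mul_sub]
    refine Dvd.dvd.mul_left ?_ _
    have := map_dvd (h₂.comp (RootAlgebra.base p d)) (hz t n)
    rw [map_pow, map_sub, map_sum] at this
    simp only [map_mul, map_pow] at this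
    exact this
  · obtain ⟨f₁, hf₁⟩ := H₁.exists_lift (liftNCRingHom ψ α fun _ _ => Commute.all _ _) (by
      rw [liftNCRingHom_single, ofAdd_zero, map_one, mul_one]
      exact hC)
    have hf₁s (g a) : f₁ (h₁ (single g a)) = ψ a * α (Multiplicative.ofAdd g) :=
      (congrArg (fun φ : AddMonoidAlgebra A (T × ℕ →₀ pFractions p) →+* C => φ (single g a))
        hf₁).trans (liftNCRingHom_single ..)
    have hf₁ι (a) : f₁ (h₁ (single 0 a)) = ψ a :=
      (hf₁s 0 a).trans (by rw [ofAdd_zero, map_one, mul_one])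
    -- The prescribed expansion and the image of the tail agree modulo every power, so `γ` takes the
    -- forced leading value.
    have hγ (t : T) : γ (Multiplicative.ofAdd (Finsupp.single t 1)) = f₁ (d t) := by
      refine eq_of_forall_pow_dvd_sub hC fun n => ?_
      have h1 := (map_dvd f₁ (hz t n)).mul_left (ψ ϖ)
      have h2 := h t n
      rw [map_pow, map_sub, hf₁ι, map_sum] at h1
      simp only [map_mul, map_pow, hf₁ι, hf₁s, map_one, one_mul] at h1
      rw [dvd_sub_comm, map_sub, map_mul, hf₁ι, hf₁ι]
      have h4 := dvd_sub h2 h1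
      convert h4 using 1
      ring
    obtain ⟨F, hF⟩ := H₂.exists_lift (RootAlgebra.lift p d f₁ γ hγ) (by
      rw [RootAlgebra.lift_base, hf₁ι]
      exact hC)
    have hFh (y) : F (h₂ y) = RootAlgebra.lift p d f₁ γ hγ y :=
      congrArg (fun φ : RootAlgebra p d →+* C => φ y) hF
    refine ⟨F, ?_, fun g => ?_, fun g => ?_⟩
    · ext a
      rw [RingHom.comp_apply, hstr, hFh, RootAlgebra.lift_base, hf₁ι]
    · rw [← ofAdd_toAdd g, hcoef, hFh, RootAlgebra.lift_base, hf₁s, map_one, one_mul]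
    · change F (h₂ _) = _
      rw [hFh, RootAlgebra.lift_root]
  · refine H₂.lift_unique hC (RootAlgebra.hom_ext (fun b => ?_) hlead)
    have : (F.comp h₂).comp (RootAlgebra.base p d) = (G.comp h₂).comp (RootAlgebra.base p d) := by
      refine H₁.lift_unique hC ?_
      refine AddMonoidAlgebra.ringHom_ext (fun a => ?_) (fun g => ?_)
      · exact congrArg (fun φ : A →+* C => φ a) hFG
      · exact hcoe (Multiplicative.ofAdd g)
    exact congrArg (fun φ : B →+* C => φ b) this

end Model

/-! ### Maps out of the model and its reduction -/

/-- The ring `C` is `π`-adically complete, `π` is a nonzerodivisor dividing `p`, and the `p`-th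
power map is bijective on `C / π`. -/
structure IsPerfectAdic (p : ℕ) {C : Type*} [CommRing C] (π : C) : Prop where
  complete : IsAdicComplete (Ideal.span {π}) C
  regular : ∀ x, π * x = 0 → x = 0
  dvd_p : π ∣ (p : C)
  perfect : PerfectRing (C ⧸ Ideal.span {π}) p

theorem mk_span_eq_iff_dvd_sub {C : Type*} [CommRing C] {π x y : C} :
    Ideal.Quotient.mk (Ideal.span {π}) x = Ideal.Quotient.mk (Ideal.span {π}) y ↔ π ∣ x - y := by
  rw [Ideal.Quotient.mk_eq_mk_iff_sub_mem, Ideal.mem_span_singleton]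

section HomExt

variable {p : ℕ} [hp : Fact p.Prime] {C : Type*} [CommRing C] {π : C}

/-- Modulo `π` the target is a perfect monoid, so agreement on variables spreads to all exponents;
uniqueness of Teichmüller lifts then gives equality in `C`. -/
theorem IsPerfectAdic.monoidHom_ext (hC : IsPerfectAdic p π) {J : Type*}
    {f g : Multiplicative (J →₀ pFractions p) →* C}
    (h : ∀ j, π ∣ f (Multiplicative.ofAdd (Finsupp.single j 1)) -
      g (Multiplicative.ofAdd (Finsupp.single j 1))) : f = g := by
  have := hC.perfect
  refine monoidHom_ext_of_dvd_sub (p := p) hC.complete hC.dvd_p fun m => ?_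
  rw [← mk_span_eq_iff_dvd_sub]
  have : (Ideal.Quotient.mk (Ideal.span {π}) : C →* C ⧸ Ideal.span {π}).comp f =
      (Ideal.Quotient.mk (Ideal.span {π}) : C →* C ⧸ Ideal.span {π}).comp g := by
    refine monoidHom_finsupp_pFractions_ext (p := p) fun j => ?_
    exact mk_span_eq_iff_dvd_sub.2 (h j)
  exact DFunLike.congr_fun this m

/-- Restricting to one variable lets digits be compared one at a time. -/
theorem IsPerfectAdic.monoidHom_eq_of_single (hC : IsPerfectAdic p π) {J : Type*}
    {f g : Multiplicative (J →₀ pFractions p) →* C} (j : J)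
    (h : π ∣ f (Multiplicative.ofAdd (Finsupp.single j 1)) -
      g (Multiplicative.ofAdd (Finsupp.single j 1))) :
    f (Multiplicative.ofAdd (Finsupp.single j 1)) =
      g (Multiplicative.ofAdd (Finsupp.single j 1)) := by
  let e : Multiplicative (Unit →₀ pFractions p) →* Multiplicative (J →₀ pFractions p) :=
    AddMonoidHom.toMultiplicative (Finsupp.mapDomain.addMonoidHom fun _ => j)
  have he (u : Unit) : e (Multiplicative.ofAdd (Finsupp.single u 1)) =
      Multiplicative.ofAdd (Finsupp.single j 1) := by
    simp [e]
  have := hC.monoidHom_ext (f := f.comp e) (g := g.comp e) fun u => by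
    simpa only [MonoidHom.comp_apply, he] using h
  have := DFunLike.congr_fun this (Multiplicative.ofAdd (Finsupp.single () 1))
  simpa only [MonoidHom.comp_apply, he] using this

end HomExt

namespace PerfectionModel

variable {p : ℕ} [hp : Fact p.Prime] {A k T : Type u} [CommRing A] [Field k]
  {ϖ : A} {θ : A →+* k} {x : T → A} {W : Type u} [CommRing W] (M : PerfectionModel p ϖ θ x W)

/-- Expansions in the model are determined by their leading term. -/
theorem hom_unique {C : Type u} [CommRing C] {F G : W →+* C}
    (hC : IsPerfectAdic p (F (M.str ϖ))) (hFG : F.comp M.str = G.comp M.str) : F = G := by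
  have hs (a : A) : G (M.str a) = F (M.str a) := (congrArg (fun φ : A →+* C => φ a) hFG).symm
  set π := F (M.str ϖ) with hπ
  have expF (t : T) (n : ℕ) := map_dvd F (M.expansion t n)
  have expG (t : T) (n : ℕ) := map_dvd G (M.expansion t n)
  simp only [map_pow, map_sub, map_mul, map_sum, hs, ← hπ] at expF expG
  have hlead : (F : W →* C).comp M.lead = (G : W →* C).comp M.lead := by
    refine hC.monoidHom_ext fun t => ?_
    have h1 := dvd_sub (expG t 1) (expF t 1)
    rw [pow_one] at h1
    refine (dvd_add_left (dvd_mul_right π (F (M.coef (Multiplicative.ofAdd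
      (Finsupp.single (t, 0) 1))) - G (M.coef (Multiplicative.ofAdd
      (Finsupp.single (t, 0) 1)))))).1 ?_
    convert h1 using 1
    simp only [Finset.sum_range_one, pow_zero, mul_one, MonoidHom.comp_apply, MonoidHom.coe_coe]
    ring
  have hcoef (t : T) (j : ℕ) : F (M.coef (Multiplicative.ofAdd (Finsupp.single (t, j) 1))) =
      G (M.coef (Multiplicative.ofAdd (Finsupp.single (t, j) 1))) := by
    induction j using Nat.strong_induction_on with
    | _ j ih =>
    refine hC.monoidHom_eq_of_single (f := (F : W →* C).comp M.coef)
      (g := (G : W →* C).comp M.coef) (t, j) ?_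
    simp only [MonoidHom.comp_apply, MonoidHom.coe_coe]
    -- One power of `π` is lost to the outer factor and `j` more to the position of the digit; `j +
    -- 2` leaves a congruence modulo `π`. The extra digit `j + 1` is absorbed in the multiple of `π
    -- ^ (j + 1)`.
    have h1 := dvd_sub (expG t (j + 2)) (expF t (j + 2))
    have hl : F (M.lead (Multiplicative.ofAdd (Finsupp.single t 1))) =
        G (M.lead (Multiplicative.ofAdd (Finsupp.single t 1))) := DFunLike.congr_fun hlead _
    rw [hl, sub_sub_sub_cancel_left, ← mul_sub, ← Finset.sum_sub_distrib, pow_succ'] at h1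
    have cancel {a b : C} (h : π * a ∣ π * b) : a ∣ b := by
      obtain ⟨c, hc⟩ := h
      exact ⟨c, sub_eq_zero.1 (hC.regular _ (by rw [mul_sub, hc]; ring))⟩
    have h2 := cancel h1
    rw [Finset.sum_range_succ, Finset.sum_range_succ, Finset.sum_eq_zero, zero_add] at h2
    · have cancel' {m : ℕ} {b : C} (h : π ^ (m + 1) ∣ π ^ m * b) : π ∣ b := by
        induction m with
        | zero => simpa using h
        | succ m ihm =>
          rw [pow_succ' π (m + 1), pow_succ' π m, mul_assoc π (π ^ m) b, ← pow_succ'] at h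
          exact ihm (cancel h)
      refine cancel' (m := j) ((dvd_add_left (a := π ^ (j + 1)) (c := π ^ (j + 1) *
        (F (M.coef (Multiplicative.ofAdd (Finsupp.single (t, j + 1) 1))) -
        G (M.coef (Multiplicative.ofAdd (Finsupp.single (t, j + 1) 1))))) (dvd_mul_right _ _)).1 ?_)
      convert h2 using 1
      ring
    · intro i hi
      rw [ih i (Finset.mem_range.1 hi), sub_self]
  refine M.hom_ext C F G hC.complete hFG (fun g => ?_) (fun g => DFunLike.congr_fun hlead g)
  have : (F : W →* C).comp M.coef = (G : W →* C).comp M.coef := by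
    refine hC.monoidHom_ext fun ⟨t, j⟩ => ?_
    simp only [MonoidHom.comp_apply, MonoidHom.coe_coe, hcoef, sub_self, dvd_zero]
  exact DFunLike.congr_fun this g

/-- Digits come from repeated division, `y = τ (y mod π) + π * q y`, with `τ` the Teichmüller map.
-/
theorem exists_hom {C : Type u} [CommRing C] (ψ : A →+* C) (hC : IsPerfectAdic p (ψ ϖ)) :
    ∃ F : W →+* C, F.comp M.str = ψ := by
  have := hC.perfect
  obtain ⟨τ, hτ⟩ := exists_monoidHom_lift (p := p) hC.complete hC.dvd_p
    (MonoidHom.id (C ⧸ Ideal.span {ψ ϖ}))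
  have hτ' (y : C) : ψ ϖ ∣ y - τ (Ideal.Quotient.mk _ y) :=
    mk_span_eq_iff_dvd_sub.1 (hτ _).symm
  choose q hq using hτ'
  -- Successive remainders, starting at `q (ψ (x t))` because the leading digit is carried by `γ`.
  let z : T → ℕ → C := fun t n => Nat.rec (q (ψ (x t))) (fun _ y => q y) n
  obtain ⟨γ, hγ⟩ := exists_monoidHom_finsupp_pFractions (p := p)
    fun t => Ideal.Quotient.mk (Ideal.span {ψ ϖ}) (ψ (x t))
  obtain ⟨α, hα⟩ := exists_monoidHom_finsupp_pFractions (p := p)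
    fun i : T × ℕ => Ideal.Quotient.mk (Ideal.span {ψ ϖ}) (z i.1 i.2)
  obtain ⟨F, hF, -⟩ := M.exists_lift C ψ (τ.comp α) (τ.comp γ) hC.complete fun t n => by
    simp only [MonoidHom.comp_apply, hγ, hα]
    have hz (n : ℕ) : q (ψ (x t)) = ∑ j ∈ Finset.range n,
        τ (Ideal.Quotient.mk _ (z t j)) * ψ ϖ ^ j + ψ ϖ ^ n * z t n := by
      induction n with
      | zero => simp [z]
      | succ n ih =>
        rw [ih, Finset.sum_range_succ, add_assoc]
        congr 1
        rw [pow_succ, mul_assoc, show z t (n + 1) = q (z t n) from rfl, ← hq]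
        ring
    rw [hq (ψ (x t)), ← mul_sub, hz n, add_sub_cancel_left]
    exact (dvd_mul_right _ _).mul_left _
  exact ⟨F, hF⟩

theorem red_eq_zero_iff (hϖ : θ ϖ = 0) (w : W) : M.red w = 0 ↔ M.str ϖ ∣ w := by
  refine ⟨M.dvd_of_red_eq_zero w, ?_⟩
  rintro ⟨y, rfl⟩
  rw [map_mul, M.red_str, hϖ, single_zero, map_zero, zero_mul]

/-- The reduction of the model. -/
noncomputable def quotientEquiv (hϖ : θ ϖ = 0) :
    W ⧸ Ideal.span {M.str ϖ} ≃+* ModelReduction p (fun t => θ (x t)) :=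
  (Ideal.quotEquivOfEq (by
    ext w
    rw [RingHom.mem_ker, M.red_eq_zero_iff hϖ, Ideal.mem_span_singleton])).trans
  (RingHom.quotientKerEquivOfSurjective M.red_surjective)

theorem quotientEquiv_mk (hϖ : θ ϖ = 0) (w : W) :
    M.quotientEquiv hϖ (Ideal.Quotient.mk _ w) = M.red w := rfl

theorem isDomain_quotient [CharP k p] (hϖ : θ ϖ = 0) (hx : IsPIndependent p fun t => θ (x t)) :
    IsDomain (W ⧸ Ideal.span {M.str ϖ}) := by
  have := RootAlgebra.isDomain p (hx.addMonoidAlgebra (T × ℕ))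
  exact (M.quotientEquiv hϖ).toMulEquiv.isDomain _

theorem isPerfectAdic [CharP k p] (hϖ : ∀ a, θ a = 0 ↔ ϖ ∣ a)
    (hx : IsPIndependent p fun t => θ (x t))
    (htop : IntermediateField.adjoin (frobenius k p).fieldRange (Set.range fun t => θ (x t)) = ⊤) :
    IsPerfectAdic p (M.str ϖ) where
  complete := M.complete
  regular := M.regular
  dvd_p := by
    have : ϖ ∣ (p : A) := (hϖ _).1 (by rw [map_natCast, CharP.cast_eq_zero])
    simpa using map_dvd M.str this
  perfect := by
    have hϖ0 : θ ϖ = 0 := (hϖ ϖ).2 dvd_rfl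
    have hdom := RootAlgebra.isDomain p (hx.addMonoidAlgebra (T × ℕ))
    have hchar : CharP (ModelReduction p fun t => θ (x t)) p := RootAlgebra.charP p _
    have hconst (b : k) : ∃ y : ModelReduction p (fun t => θ (x t)),
        y ^ p = RootAlgebra.base p _ (single 0 b) := by
      let f : k →+* ModelReduction p (fun t => θ (x t)) :=
        (RootAlgebra.base p _).comp singleZeroRingHom
      -- The constants whose images are `p`-th powers form a subring containing all `p`-th powers
      -- and the `p`-basis, hence everything.
      refine mem_of_adjoin_eq_top htop
        ((frobenius (ModelReduction p fun t => θ (x t)) p).range.comap f) (fun y => ?_)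
        (fun t => ?_) b
      · exact ⟨f y, by rw [frobenius_def, map_pow]⟩
      · obtain ⟨g, hg⟩ := exists_nsmul_finsupp_eq (p := p)
          (Finsupp.single t 1 : T →₀ pFractions p)
        refine ⟨RootAlgebra.root p _ (Multiplicative.ofAdd g), ?_⟩
        rw [frobenius_def, ← map_pow, ← ofAdd_nsmul, hg, RootAlgebra.root_single_one]
        rfl
    have hpow := RootAlgebra.exists_pow_eq p
      (fun t => (single 0 (θ (x t)) : AddMonoidAlgebra k (T × ℕ →₀ pFractions p))) fun r => by
        induction r using AddMonoidAlgebra.induction_linear with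
        | zero => exact ⟨0, by rw [zero_pow hp.out.ne_zero, map_zero]⟩
        | add r s hr hs =>
          obtain ⟨y, hy⟩ := hr
          obtain ⟨z, hz⟩ := hs
          exact ⟨y + z, by rw [add_pow_char, hy, hz, map_add]⟩
        | single g b =>
          obtain ⟨y, hy⟩ := hconst b
          obtain ⟨h, rfl⟩ := exists_nsmul_finsupp_eq (p := p) g
          refine ⟨y * RootAlgebra.base p _ (single h 1), ?_⟩
          rw [mul_pow, hy, ← map_pow, single_pow, one_pow, ← map_mul, single_mul_single, zero_add,
            mul_one]
    refine ⟨fun a b hab => ?_, fun b => ?_⟩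
    · refine (M.quotientEquiv hϖ0).injective (frobenius_inj _ p ?_)
      have := congrArg (M.quotientEquiv hϖ0) hab
      simpa only [map_pow, frobenius_def] using this
    · obtain ⟨y, hy⟩ := hpow (M.quotientEquiv hϖ0 b)
      refine ⟨(M.quotientEquiv hϖ0).symm y, ?_⟩
      change _ ^ p = b
      rw [← map_pow, hy, RingEquiv.symm_apply_apply]

/-- A map of models that sends the coefficients of `M` injectively to those of `M'` is injective on
reductions. -/
theorem exists_hom_injective [CharP k p] (hθ : Function.Surjective θ) (hϖ : θ ϖ = 0)
    (hx : IsPIndependent p fun t => θ (x t))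
    {A' k' T' W' : Type u} [CommRing A'] [Field k'] [CommRing W'] {ϖ' : A'} {θ' : A' →+* k'}
    {x' : T' → A'} (M' : PerfectionModel p ϖ' θ' x' W') (hϖ' : θ' ϖ' = 0) (f : A →+* A')
    (hf : f ϖ = ϖ') (fk : k →+* k') (hfk : fk.comp θ = θ'.comp f) (ι : T → T')
    (hι : Function.Injective ι) (hxι : ∀ t, x' (ι t) = f (x t)) :
    ∃ F : W →+* W', F.comp M.str = M'.str.comp f ∧
      ∀ w, M'.str ϖ' ∣ F w → M.str ϖ ∣ w := by
  subst hf
  let e : Multiplicative (T × ℕ →₀ pFractions p) →* Multiplicative (T' × ℕ →₀ pFractions p) :=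
    AddMonoidHom.toMultiplicative (Finsupp.mapDomain.addMonoidHom (Prod.map ι id))
  let e' : Multiplicative (T →₀ pFractions p) →* Multiplicative (T' →₀ pFractions p) :=
    AddMonoidHom.toMultiplicative (Finsupp.mapDomain.addMonoidHom ι)
  -- The expansion of `x' (ι t)` in `M'` serves as an expansion of the image of `x t`, so digits can
  -- be matched variable by variable.
  obtain ⟨F, hF, hFc, -⟩ := M.exists_lift W' (M'.str.comp f) (M'.coef.comp e) (M'.lead.comp e')
    M'.complete fun t n => by
      have he (j : ℕ) : e (Multiplicative.ofAdd (Finsupp.single (t, j) 1)) =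
          Multiplicative.ofAdd (Finsupp.single (ι t, j) 1) := by simp [e]
      have he' : e' (Multiplicative.ofAdd (Finsupp.single t 1)) =
          Multiplicative.ofAdd (Finsupp.single (ι t) 1) := by simp [e']
      simp only [MonoidHom.comp_apply, RingHom.comp_apply, he, he', ← hxι]
      exact M'.expansion (ι t) n
  refine ⟨F, hF, fun w hw => ?_⟩
  rw [← M.red_eq_zero_iff hϖ]
  obtain ⟨Φ, hΦ⟩ : ∃ Φ : ModelReduction p (fun t => θ (x t)) →+*
      ModelReduction p (fun t => θ' (x' t)), ∀ w, Φ (M.red w) = M'.red (F w) := by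
    refine ⟨(Ideal.Quotient.lift (Ideal.span {M.str ϖ}) (M'.red.comp F) fun a ha => ?_).comp
      (M.quotientEquiv hϖ).symm, fun w => ?_⟩
    · obtain ⟨b, rfl⟩ := Ideal.mem_span_singleton.1 ha
      have : F (M.str ϖ) = M'.str (f ϖ) := congrArg (fun φ : A →+* W' => φ ϖ) hF
      rw [RingHom.comp_apply, map_mul, this, M'.red_eq_zero_iff hϖ']
      exact dvd_mul_right _ _
    · rw [← M.quotientEquiv_mk hϖ]
      simp
  have hbase (y) : Φ (RootAlgebra.base p _ y) = RootAlgebra.base p _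
      (mapRingHom _ fk (mapDomain (Finsupp.mapDomain (Prod.map ι id)) y)) := by
    induction y using AddMonoidAlgebra.induction_linear with
    | zero => simp
    | add y z hy hz => simp only [map_add, mapDomain_add, hy, hz]
    | single g b =>
      obtain ⟨a, rfl⟩ := hθ b
      have h1 : RootAlgebra.base p (fun t => single 0 (θ (x t))) (single g (θ a)) =
          M.red (M.str a * M.coef (Multiplicative.ofAdd g)) := by
        rw [map_mul, M.red_str, M.red_coef, ← map_mul, single_mul_single, zero_add, mul_one]
      have h2 : F (M.str a) = M'.str (f a) := congrArg (fun φ : A →+* W' => φ a) hF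
      have h3 : F (M.coef (Multiplicative.ofAdd g)) =
          M'.coef (Multiplicative.ofAdd (Finsupp.mapDomain (Prod.map ι id) g)) := hFc _
      have h4 : fk (θ a) = θ' (f a) := congrArg (fun φ : A →+* k' => φ a) hfk
      rw [h1, hΦ, map_mul, map_mul, h2, h3, M'.red_str, M'.red_coef, ← map_mul, single_mul_single,
        zero_add, mul_one, mapDomain_single, mapRingHom_single, h4]
  -- Pure inseparability reduces injectivity to the polynomial base, where the map extends
  -- coefficients along `fk` and renames variables injectively.
  have hinj := RootAlgebra.injective_of_injective_base p (hx.addMonoidAlgebra (T × ℕ)) Φ (by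
    intro y z hyz
    rw [RingHom.comp_apply, RingHom.comp_apply, hbase, hbase] at hyz
    have h1 := RootAlgebra.base_injective p _ hyz
    have h2 := AddMonoidAlgebra.map_injective (f := (fk : k →+ k')) fk.injective h1
    exact AddMonoidAlgebra.mapDomain_injective
      (Finsupp.mapDomain_injective (hι.prodMap Function.injective_id)) h2)
  refine hinj ?_
  rw [map_zero, hΦ, M'.red_eq_zero_iff hϖ']
  exact hw

end PerfectionModel

theorem IsPIndependent.exists_extension {p : ℕ} [Fact p.Prime] {T l : Type u} [Field l] [CharP l p]
    {d : T → l} (hd : IsPIndependent p d) : ∃ (T' : Type u) (d' : T' → l) (ι : T → T'),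
      Function.Injective ι ∧ (∀ t, d' (ι t) = d t) ∧ IsPIndependent p d' ∧
      IntermediateField.adjoin (frobenius l p).fieldRange (Set.range d') = ⊤ := by
  -- Indexing by `T ⊕ l` makes the family surjective while retaining `T` as a set of indices to
  -- extend.
  let v : T ⊕ l → l := Sum.elim d id
  obtain ⟨s, hs, hind, htop⟩ := exists_isPIndependentOn_adjoin_eq_top (p := p) (v := v)
    (fun y => ⟨Sum.inr y, rfl⟩) ((isPIndependentOn_range_iff Sum.inl_injective).2 hd)
  refine ⟨s, v ∘ Subtype.val, fun t => ⟨Sum.inl t, hs ⟨t, rfl⟩⟩,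
    fun t t' h => Sum.inl_injective (congrArg Subtype.val h), fun t => rfl, ?_, ?_⟩
  · rw [← isPIndependentOn_range_iff Subtype.val_injective, Subtype.range_coe]
    exact hind
  · rw [Set.range_comp, Subtype.range_coe]
    exact htop

theorem Submodule.torsion_eq_bot_iff_forall {R M : Type*} [CommRing R] [AddCommGroup M]
    [Module R M] :
    torsion R M = ⊥ ↔ ∀ r ∈ nonZeroDivisors R, ∀ x : M, r • x = 0 → x = 0 := by
  rw [Submodule.eq_bot_iff]
  refine ⟨fun h r hr x hx => h x ((mem_torsion_iff x).2 ⟨⟨r, hr⟩, hx⟩), fun h x hx => ?_⟩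
  obtain ⟨r, hr⟩ := (mem_torsion_iff x).1 hx
  exact h r r.2 x hr

/-! ### Complete residual perfections in terms of a uniformizer -/

section DiscreteValuationRing

variable {p : ℕ} {A : Type u} [CommRing A] [IsDomain A] [IsDiscreteValuationRing A] {ϖ : A}

theorem extIdeal_eq_span (hϖ : Irreducible ϖ) (C : Type u) [CommRing C] [Algebra A C] :
    extIdeal A C = Ideal.span {algebraMap A C ϖ} := by
  rw [extIdeal, hϖ.maximalIdeal_eq, Ideal.map_span, Set.image_singleton]

theorem reduction_mk_eq_zero_iff (hϖ : Irreducible ϖ) {C : Type u} [CommRing C] [Algebra A C]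
    {x : C} : Ideal.Quotient.mk (extIdeal A C) x = 0 ↔ algebraMap A C ϖ ∣ x := by
  rw [Ideal.Quotient.eq_zero_iff_mem, extIdeal_eq_span hϖ, Ideal.mem_span_singleton]

theorem residue_eq_zero_iff_dvd (hϖ : Irreducible ϖ) (a : A) : residue A a = 0 ↔ ϖ ∣ a := by
  rw [residue_eq_zero_iff, hϖ.maximalIdeal_eq, Ideal.mem_span_singleton]

/-- Flat means torsion-free here, and every nonzero element is a unit times a power of `ϖ`. -/
theorem flat_iff_forall_uniformizer_mul (hϖ : Irreducible ϖ) {C : Type u} [CommRing C]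
    [Algebra A C] :
    Module.Flat A C ↔ ∀ x : C, algebraMap A C ϖ * x = 0 → x = 0 := by
  rw [Module.Flat.flat_iff_torsion_eq_bot_of_isBezout, Submodule.torsion_eq_bot_iff_forall]
  refine ⟨fun h x hx => h ϖ (mem_nonZeroDivisors_of_ne_zero hϖ.ne_zero) x (by
    rwa [Algebra.smul_def]), fun h r hr x hx => ?_⟩
  obtain ⟨n, u, hu⟩ := IsDiscreteValuationRing.associated_pow_irreducible
    (nonZeroDivisors.ne_zero hr) hϖ
  have hx' : algebraMap A C ϖ ^ n * x = 0 := by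
    rw [← map_pow, ← hu, map_mul, mul_right_comm, ← Algebra.smul_def, hx, zero_mul]
  clear hu hx
  induction n with
  | zero => simpa using hx'
  | succ n ih => exact ih (h _ (by rw [← mul_assoc, ← pow_succ', hx']))

theorem isCompleteResidualPerfection_iff [Fact p.Prime] [CharP (ResidueField A) p]
    (hϖ : Irreducible ϖ) {C : Type u} [CommRing C] [Algebra A C] :
    IsCompleteResidualPerfection p A C ↔ IsPerfectAdic p (algebraMap A C ϖ) := by
  have hI : extIdeal A C = Ideal.span {algebraMap A C ϖ} := extIdeal_eq_span hϖ C
  have hperf {I J : Ideal C} (h : I = J) : PerfectRing (C ⧸ I) p → PerfectRing (C ⧸ J) p := by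
    subst h
    exact id
  refine ⟨fun h => ⟨hI ▸ h.complete, (flat_iff_forall_uniformizer_mul hϖ).1 h.flat, ?_,
    hperf hI h.perfect⟩, fun h => ⟨(flat_iff_forall_uniformizer_mul hϖ).2 h.regular,
    hI ▸ h.complete, hperf hI.symm h.perfect⟩⟩
  have : ϖ ∣ (p : A) := by
    rw [← residue_eq_zero_iff_dvd hϖ, map_natCast, CharP.cast_eq_zero]
  simpa using map_dvd (algebraMap A C) this

end DiscreteValuationRing

/-! ### Existence and mapping properties of the universal residual perfection -/

section Universal

variable {p : ℕ} [hp : Fact p.Prime] {A : Type u} [CommRing A] [IsDomain A]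
  [IsDiscreteValuationRing A] [CharP (ResidueField A) p] {ϖ : A}

/-- Initiality stated for bare ring maps, so that it applies to targets that are given as algebras
over `B`. -/
theorem IsUniversalResidualPerfection.exists_ringHom {U : Type u} [CommRing U] [Algebra A U]
    (hU : IsUniversalResidualPerfection p A U) (hϖ : Irreducible ϖ) {C : Type u} [CommRing C]
    (ψ : A →+* C) (hC : IsPerfectAdic p (ψ ϖ)) : ∃ F : U →+* C, F.comp (algebraMap A U) = ψ := by
  let := ψ.toAlgebra
  obtain ⟨F, -⟩ := hU.existsUnique_hom C ((isCompleteResidualPerfection_iff hϖ).2 hC)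
  exact ⟨F, F.comp_algebraMap⟩

theorem IsUniversalResidualPerfection.ringHom_ext {U : Type u} [CommRing U] [Algebra A U]
    (hU : IsUniversalResidualPerfection p A U) (hϖ : Irreducible ϖ) {C : Type u} [CommRing C]
    {F G : U →+* C} (hC : IsPerfectAdic p (F (algebraMap A U ϖ)))
    (h : F.comp (algebraMap A U) = G.comp (algebraMap A U)) : F = G := by
  let := (F.comp (algebraMap A U)).toAlgebra
  obtain ⟨f, hf⟩ := hU.existsUnique_hom C ((isCompleteResidualPerfection_iff hϖ).2 hC)
  let F' : U →ₐ[A] C := { F with commutes' := fun a => rfl }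
  let G' : U →ₐ[A] C := { G with
    commutes' := fun a => (congrArg (fun φ : A →+* C => φ a) h).symm }
  have := congrArg (fun φ : U →ₐ[A] C => (φ : U →+* C)) ((hf F').trans (hf G').symm)
  exact this

/-- A model on a lifted `p`-basis of the residue field that extends a given family. -/
theorem exists_perfectionModel_extending (hϖ : Irreducible ϖ) {T : Type u} {x : T → A}
    (hx : IsPIndependent p fun t => residue A (x t)) :
    ∃ (T' : Type u) (x' : T' → A) (ι : T → T') (W : Type u) (_ : CommRing W)
      (M : PerfectionModel p ϖ (residue A) x' W), Function.Injective ι ∧ (∀ t, x' (ι t) = x t) ∧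
      IsPIndependent p (fun t => residue A (x' t)) ∧ IsPerfectAdic p (M.str ϖ) := by
  classical
  obtain ⟨T', d', ι, hι, hd', hind, htop⟩ := hx.exists_extension
  have hlift (t' : T') : ∃ a, residue A a = d' t' ∧ ∀ t, ι t = t' → a = x t := by
    by_cases h : ∃ t, ι t = t'
    · obtain ⟨t, rfl⟩ := h
      exact ⟨x t, (hd' t).symm, fun s hs => by rw [hι hs]⟩
    · obtain ⟨a, ha⟩ := residue_surjective (d' t')
      exact ⟨a, ha, fun t ht => (h ⟨t, ht⟩).elim⟩
  choose x' hx' hxι using hlift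
  obtain rfl : (fun t => residue A (x' t)) = d' := funext hx'
  obtain ⟨W, _, ⟨M⟩⟩ := exists_perfectionModel p ϖ
    (fun a ha => (mul_eq_zero.1 ha).resolve_left hϖ.ne_zero) (residue A) residue_surjective
    (residue_eq_zero_iff_dvd hϖ) x'
  exact ⟨T', x', ι, W, inferInstance, M, hι, fun t => hxι _ t rfl, hind,
    M.isPerfectAdic (residue_eq_zero_iff_dvd hϖ) hind htop⟩

theorem PerfectionModel.isUniversalResidualPerfection (hϖ : Irreducible ϖ) {T W : Type u}
    [CommRing W] [Algebra A W] {x : T → A} (M : PerfectionModel p ϖ (residue A) x W)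
    (hM : M.str = algebraMap A W) (hW : IsPerfectAdic p (M.str ϖ)) :
    IsUniversalResidualPerfection p A W where
  isCRP := (isCompleteResidualPerfection_iff hϖ).2 (hM ▸ hW)
  existsUnique_hom := fun C _ _ hC => by
    have hC' := (isCompleteResidualPerfection_iff hϖ).1 hC
    obtain ⟨F, hF⟩ := M.exists_hom (algebraMap A C) hC'
    have hF' (a : A) : F (M.str a) = algebraMap A C a := congrArg (fun φ : A →+* C => φ a) hF
    refine ⟨{ F with commutes' := fun a => by rw [← hF', hM]; rfl }, fun g => ?_⟩
    have h : (g : W →+* C) = F := M.hom_unique (by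
      rw [hM, RingHom.coe_coe, AlgHom.commutes]
      exact hC') (by rw [hF, hM]; exact g.comp_algebraMap)
    exact AlgHom.ext fun w => congrArg (fun φ : W →+* C => φ w) h

theorem exists_isUniversalResidualPerfection (p : ℕ) [Fact p.Prime] (A : Type u) [CommRing A]
    [IsDomain A] [IsDiscreteValuationRing A] [CharP (ResidueField A) p] :
    ∃ (U : Type u) (_ : CommRing U) (_ : Algebra A U), IsUniversalResidualPerfection p A U ∧
      IsDomain (Reduction A U) := by
  obtain ⟨ϖ, hϖ⟩ := IsDiscreteValuationRing.exists_irreducible A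
  -- Extending the empty family yields a full lifted `p`-basis.
  obtain ⟨T, x, -, W, _, M, -, -, hx, hW⟩ := exists_perfectionModel_extending (p := p) hϖ
    (T := PEmpty) (x := PEmpty.elim) (isPIndependent_of_isEmpty _)
  let := M.str.toAlgebra
  refine ⟨W, inferInstance, inferInstance, M.isUniversalResidualPerfection hϖ rfl hW, ?_⟩
  have := M.isDomain_quotient ((residue_eq_zero_iff_dvd hϖ ϖ).2 dvd_rfl) hx
  have hI : extIdeal A W = Ideal.span {M.str ϖ} := extIdeal_eq_span hϖ W
  exact (Ideal.quotEquivOfEq hI).toMulEquiv.isDomain _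

end Universal

/-! ### Generic residual perfections as completed localizations -/

theorem isFractionFieldMap_iff {R S : Type u} [CommRing R] [CommRing S] {φ : R →+* S} :
    IsFractionFieldMap φ ↔ IsDomain R ∧ (∀ r, r ≠ 0 → IsUnit (φ r)) ∧
      (∀ s, ∃ a b, b ≠ 0 ∧ s * φ b = φ a) ∧ Function.Injective φ := by
  let := φ.toAlgebra
  refine and_congr_right fun hR => ⟨fun (h : IsFractionRing R S) => ⟨fun r hr => ?_, fun s => ?_,
    IsFractionRing.injective R S⟩, fun ⟨h1, h2, h3⟩ => ?_⟩
  · exact IsLocalization.map_units S ⟨r, mem_nonZeroDivisors_of_ne_zero hr⟩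
  · obtain ⟨⟨a, b⟩, h⟩ := IsLocalization.surj (nonZeroDivisors R) s
    exact ⟨a, b, nonZeroDivisors.ne_zero b.2, h⟩
  · refine (isLocalization_iff (nonZeroDivisors R) S).2
      ⟨fun y => h1 y (nonZeroDivisors.ne_zero y.2), fun s => ?_,
        fun {x y} hxy => ⟨1, congrArg _ (h3 hxy)⟩⟩
    obtain ⟨a, b, hb, h⟩ := h2 s
    exact ⟨(a, ⟨b, mem_nonZeroDivisors_of_ne_zero hb⟩), h⟩

theorem IsFractionFieldMap.perfectRing {p : ℕ} [hp : Fact p.Prime] {R S : Type u} [CommRing R]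
    [CommRing S] {φ : R →+* S} (hφ : IsFractionFieldMap φ) [PerfectRing R p]
    (hS : (p : S) = 0) : PerfectRing S p := by
  obtain ⟨hR, hunit, hfrac, -⟩ := isFractionFieldMap_iff.1 hφ
  have hdom : IsDomain S := by
    let := φ.toAlgebra
    have : IsFractionRing R S := hφ.2
    exact IsFractionRing.isDomain R
  have : CharP S p := (CharP.charP_iff_prime_eq_zero hp.out).2 hS
  refine ⟨fun a b hab => frobenius_inj S p ?_, fun s => ?_⟩
  · simpa only [frobenius_def] using hab
  · obtain ⟨a, b, hb, h⟩ := hfrac s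
    obtain ⟨a, rfl⟩ := exists_pow_pow_eq (p := p) 1 a
    obtain ⟨b, rfl⟩ := exists_pow_pow_eq (p := p) 1 b
    simp only [pow_one] at h hb
    obtain ⟨c, hc⟩ := (hunit b fun h0 => hb (by rw [h0, zero_pow hp.out.ne_zero])).exists_right_inv
    refine ⟨φ a * c, ?_⟩
    change _ ^ p = s
    rw [map_pow, map_pow] at h
    rw [mul_pow, ← h, mul_assoc, ← mul_pow, hc, one_pow, mul_one]

section Generic

variable {p : ℕ} {A : Type u} [CommRing A] [IsDomain A] [IsDiscreteValuationRing A] {ϖ : A}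
  {U G : Type u} [CommRing U] [Algebra A U] [CommRing G] [Algebra A G] {f : U →ₐ[A] G}

theorem mem_extIdeal_iff (hϖ : Irreducible ϖ) {u : U} :
    u ∈ extIdeal A U ↔ algebraMap A U ϖ ∣ u := by
  rw [extIdeal_eq_span hϖ, Ideal.mem_span_singleton]

/-- Such `u` has nonzero image in the fraction field, and units lift along the complete ideal. -/
theorem isUnit_of_not_dvd (hϖ : Irreducible ϖ)
    (hG : IsAdicComplete (Ideal.span {algebraMap A G ϖ}) G)
    (hf : IsFractionFieldMap (reductionMap f)) {u : U} (hu : ¬ algebraMap A U ϖ ∣ u) :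
    IsUnit (f u) := by
  obtain ⟨-, hunit, -⟩ := isFractionFieldMap_iff.1 hf
  obtain ⟨c, hc⟩ := (hunit (Ideal.Quotient.mk _ u) fun h =>
    hu ((reduction_mk_eq_zero_iff hϖ).1 h)).exists_right_inv
  obtain ⟨y, rfl⟩ := Ideal.Quotient.mk_surjective c
  refine isUnit_of_dvd_mul_sub_one hG (y := y) ((reduction_mk_eq_zero_iff hϖ).1 ?_)
  rw [map_sub, map_mul, map_one, sub_eq_zero]
  exact hc

theorem dvd_of_dvd_map (hϖ : Irreducible ϖ) (hf : IsFractionFieldMap (reductionMap f)) {u : U}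
    (hu : algebraMap A G ϖ ∣ f u) : algebraMap A U ϖ ∣ u := by
  obtain ⟨-, -, -, hinj⟩ := isFractionFieldMap_iff.1 hf
  refine (reduction_mk_eq_zero_iff hϖ).1 (hinj ?_)
  rw [map_zero]
  exact (reduction_mk_eq_zero_iff hϖ).2 hu

/-- `G` is the `ϖ`-completion of `U` localized at `(ϖ)`: both reduce to the fraction field of `U /
ϖ`. This supplies the mapping property of `G`. -/
theorem exists_isAdicDense_localization (hϖ : Irreducible ϖ)
    (hG : IsAdicComplete (Ideal.span {algebraMap A G ϖ}) G)
    (hreg : ∀ x, algebraMap A G ϖ * x = 0 → x = 0)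
    (hf : IsFractionFieldMap (reductionMap f)) [(extIdeal A U).IsPrime] :
    ∃ h : Localization.AtPrime (extIdeal A U) →+* G,
      h.comp (algebraMap U _) = f ∧ IsAdicDense h (algebraMap U _ (algebraMap A U ϖ)) := by
  have hmem (s : (extIdeal A U).primeCompl) : ¬ algebraMap A U ϖ ∣ s := fun h =>
    s.2 ((mem_extIdeal_iff hϖ).2 h)
  have hunit (s : (extIdeal A U).primeCompl) : IsUnit ((f : U →+* G) s) :=
    isUnit_of_not_dvd hϖ hG hf (hmem s)
  have hlift : (IsLocalization.lift hunit : Localization.AtPrime (extIdeal A U) →+* G).comp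
    (algebraMap U _) = f := IsLocalization.lift_comp hunit
  have hl (u : U) : (IsLocalization.lift hunit : Localization.AtPrime (extIdeal A U) →+* G)
    (algebraMap U _ u) = f u := IsLocalization.lift_eq hunit u
  refine ⟨_, hlift, fun x hx => ?_, fun g => ?_, fun r hr => ?_⟩
  · rw [hl, f.commutes] at hx
    exact hreg x hx
  · obtain ⟨-, -, hfrac, -⟩ := isFractionFieldMap_iff.1 hf
    obtain ⟨a, b, hb, h⟩ := hfrac (Ideal.Quotient.mk _ g)
    obtain ⟨a, rfl⟩ := Ideal.Quotient.mk_surjective a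
    obtain ⟨b, rfl⟩ := Ideal.Quotient.mk_surjective b
    have hb' : b ∈ (extIdeal A U).primeCompl := fun h0 => hb (Ideal.Quotient.eq_zero_iff_mem.2 h0)
    have h' : algebraMap A G ϖ ∣ g * f b - f a := by
      rw [← reduction_mk_eq_zero_iff hϖ, map_sub, map_mul, sub_eq_zero]
      exact h
    obtain ⟨c, hc⟩ := (hunit ⟨b, hb'⟩).exists_right_inv
    refine ⟨IsLocalization.mk' _ a ⟨b, hb'⟩, ?_⟩
    have hac : (IsLocalization.lift hunit : Localization.AtPrime (extIdeal A U) →+* G)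
        (IsLocalization.mk' _ a ⟨b, hb'⟩) = f a * c := by
      rw [IsLocalization.lift_mk'_spec, mul_comm (f a) c, ← mul_assoc, hc, one_mul]
      rfl
    rw [hl, f.commutes, hac]
    have h2 := h'.mul_right c
    rwa [sub_mul, mul_assoc, show f b * c = 1 from hc, mul_one] at h2
  · obtain ⟨a, s, rfl⟩ := IsLocalization.exists_mk'_eq (extIdeal A U).primeCompl r
    rw [hl, f.commutes] at hr
    have ha : algebraMap A G ϖ ∣ f a := by
      have h1 := hr.mul_right (f s)
      rwa [← hl, ← map_mul, IsLocalization.mk'_spec, hl] at h1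
    obtain ⟨c, rfl⟩ := dvd_of_dvd_map hϖ hf ha
    exact ⟨IsLocalization.mk' _ c s, (IsLocalization.mul_mk'_eq_mk'_of_mul _ _ _).symm⟩

/-- A map out of `U` that inverts every element with nonzero reduction extends uniquely to a
generic residual perfection. -/
theorem existsUnique_extension (hϖ : Irreducible ϖ)
    (hG : IsAdicComplete (Ideal.span {algebraMap A G ϖ}) G)
    (hreg : ∀ x, algebraMap A G ϖ * x = 0 → x = 0)
    (hf : IsFractionFieldMap (reductionMap f)) {C : Type u} [CommRing C] (φ : U →+* C)
    (hC : IsAdicComplete (Ideal.span {φ (algebraMap A U ϖ)}) C)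
    (hφ : ∀ u, ¬ algebraMap A U ϖ ∣ u → IsUnit (φ u)) :
    ∃! Ψ : G →+* C, Ψ.comp f = φ := by
  have : IsDomain (Reduction A U) := hf.1
  have hprime : (extIdeal A U).IsPrime := (Ideal.Quotient.isDomain_iff_prime _).1 this
  obtain ⟨h, hhf, H⟩ := exists_isAdicDense_localization hϖ hG hreg hf
  have hunit (s : (extIdeal A U).primeCompl) : IsUnit (φ s) := hφ s fun h =>
    s.2 ((mem_extIdeal_iff hϖ).2 h)
  have hlift : (IsLocalization.lift hunit : Localization.AtPrime (extIdeal A U) →+* C).comp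
    (algebraMap U _) = φ := IsLocalization.lift_comp hunit
  obtain ⟨Ψ, hΨ⟩ := H.exists_lift (IsLocalization.lift hunit) (by
    rw [IsLocalization.lift_eq]
    exact hC)
  refine ⟨Ψ, ?_, fun Ψ' hΨ' => H.lift_unique ?_ ?_⟩
  · change Ψ.comp f = φ
    rw [← hhf, ← RingHom.comp_assoc, hΨ, hlift]
  · have h1 : h (algebraMap U _ (algebraMap A U ϖ)) = f (algebraMap A U ϖ) :=
      congrArg (fun F : U →+* G => F (algebraMap A U ϖ)) hhf
    have h2 : Ψ' (f (algebraMap A U ϖ)) = φ (algebraMap A U ϖ) :=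
      congrArg (fun F : U →+* C => F (algebraMap A U ϖ)) hΨ'
    rw [h1, h2]
    exact hC
  · refine IsLocalization.ringHom_ext (extIdeal A U).primeCompl ?_
    rw [hΨ, hlift, RingHom.comp_assoc, hhf]
    exact hΨ'

end Generic

theorem exists_isGenericResidualPerfection (p : ℕ) [Fact p.Prime] (A : Type u) [CommRing A]
    [IsDomain A] [IsDiscreteValuationRing A] [CharP (ResidueField A) p] :
    ∃ (G : Type u) (_ : CommRing G) (_ : Algebra A G), IsGenericResidualPerfection p A G := by
  obtain ⟨ϖ, hϖ⟩ := IsDiscreteValuationRing.exists_irreducible A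
  obtain ⟨U, _, _, hU, hdom⟩ := exists_isUniversalResidualPerfection p A
  have hUϖ := (isCompleteResidualPerfection_iff hϖ).1 hU.isCRP
  have hprime : (extIdeal A U).IsPrime := (Ideal.Quotient.isDomain_iff_prime _).1 hdom
  -- Localizing at `(ϖ)` inverts exactly the elements with nonzero reduction and keeps `ϖ` regular;
  -- completing keeps the reduction.
  obtain ⟨G, _, h, H, hG⟩ := exists_adicCompletion (Localization.AtPrime (extIdeal A U))
    (algebraMap U _ (algebraMap A U ϖ)) fun y hy => by
      obtain ⟨a, s, rfl⟩ := IsLocalization.exists_mk'_eq (extIdeal A U).primeCompl y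
      rw [IsLocalization.mul_mk'_eq_mk'_of_mul, IsLocalization.mk'_eq_zero_iff] at hy
      obtain ⟨t, ht⟩ := hy
      rw [IsLocalization.mk'_eq_zero_iff]
      exact ⟨t, hUϖ.regular _ (by rw [← ht]; ring)⟩
  let : Algebra A G := ((h.comp (algebraMap U _)).comp (algebraMap A U)).toAlgebra
  let f : U →ₐ[A] G := { h.comp (algebraMap U _) with commutes' := fun a => rfl }
  have hff : IsFractionFieldMap (reductionMap f) := by
    refine isFractionFieldMap_iff.2 ⟨hdom, fun r hr => ?_, fun g => ?_, ?_⟩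
    · obtain ⟨u, rfl⟩ := Ideal.Quotient.mk_surjective r
      have hu : u ∈ (extIdeal A U).primeCompl := fun h => hr (Ideal.Quotient.eq_zero_iff_mem.2 h)
      have : IsUnit (f u) := (IsLocalization.map_units
        (Localization.AtPrime (extIdeal A U)) (⟨u, hu⟩ : (extIdeal A U).primeCompl)).map h
      exact this.map (Ideal.Quotient.mk (extIdeal A G))
    · obtain ⟨g, rfl⟩ := Ideal.Quotient.mk_surjective g
      obtain ⟨r, hr⟩ := H.surj g
      obtain ⟨a, s, rfl⟩ := IsLocalization.exists_mk'_eq (extIdeal A U).primeCompl r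
      refine ⟨Ideal.Quotient.mk _ a, Ideal.Quotient.mk _ s,
        fun h => s.2 (Ideal.Quotient.eq_zero_iff_mem.1 h), ?_⟩
      have hg : Ideal.Quotient.mk (extIdeal A G) g = Ideal.Quotient.mk (extIdeal A G)
          (h (IsLocalization.mk' _ a s)) := by
        rw [← sub_eq_zero, ← map_sub]
        exact (reduction_mk_eq_zero_iff hϖ).2 hr
      rw [hg]
      change Ideal.Quotient.mk (extIdeal A G) _ * Ideal.Quotient.mk (extIdeal A G) (h _) =
        Ideal.Quotient.mk (extIdeal A G) (h _)
      rw [← map_mul, ← map_mul, IsLocalization.mk'_spec]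
    · rw [injective_iff_map_eq_zero]
      intro r hr
      obtain ⟨u, rfl⟩ := Ideal.Quotient.mk_surjective r
      have hu : algebraMap A G ϖ ∣ f u := (reduction_mk_eq_zero_iff hϖ).1 hr
      obtain ⟨y, hy⟩ := H.dvd _ hu
      obtain ⟨a, s, rfl⟩ := IsLocalization.exists_mk'_eq (extIdeal A U).primeCompl y
      have h1 : algebraMap U (Localization.AtPrime (extIdeal A U)) (u * s) =
          algebraMap U (Localization.AtPrime (extIdeal A U)) (algebraMap A U ϖ * a) := by
        rw [map_mul, hy, mul_assoc, IsLocalization.mk'_spec, map_mul]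
      obtain ⟨c, hc⟩ := (IsLocalization.eq_iff_exists (extIdeal A U).primeCompl _).1 h1
      have h2 : c * (u * s) ∈ extIdeal A U := by
        rw [hc, mem_extIdeal_iff hϖ]
        exact (dvd_mul_right _ _).mul_left _
      exact Ideal.Quotient.eq_zero_iff_mem.2
        ((hprime.mem_or_mem ((hprime.mem_or_mem h2).resolve_left c.2)).resolve_right s.2)
  have hperf := hU.isCRP.perfect
  refine ⟨G, inferInstance, inferInstance,
    ⟨(flat_iff_forall_uniformizer_mul hϖ).2 H.regular, ?_, hff.perfectRing ?_⟩,
    U, inferInstance, inferInstance, f, hU, hff⟩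
  · rw [extIdeal_eq_span hϖ]
    exact hG
  · have := (reduction_mk_eq_zero_iff hϖ (C := G) (x := (p : G))).2 ?_
    · rwa [map_natCast] at this
    · have := map_dvd f hUϖ.dvd_p
      rwa [map_natCast, f.commutes] at this

/-! ### Unramified, residually separable extensions -/

section Extension

variable {p : ℕ} [hp : Fact p.Prime]
  {A : Type u} [CommRing A] [IsDomain A] [IsDiscreteValuationRing A] [CharP (ResidueField A) p]
  {B : Type u} [CommRing B] [IsDomain B] [IsDiscreteValuationRing B] [CharP (ResidueField B) p]
  [Algebra A B] {ϖ : A}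

theorem irreducible_algebraMap_of_ramificationIdx_eq_one (hϖ : Irreducible ϖ)
    (hinj : Function.Injective (algebraMap A B))
    (he : Ideal.ramificationIdx' (maximalIdeal A) (maximalIdeal B) = 1) :
    Irreducible (algebraMap A B ϖ) := by
  obtain ⟨τ, hτ⟩ := IsDiscreteValuationRing.exists_irreducible B
  obtain ⟨n, hn⟩ := IsDiscreteValuationRing.associated_pow_irreducible
    ((map_ne_zero_iff _ hinj).2 hϖ.ne_zero) hτ
  have hle (m : ℕ) : (maximalIdeal A).map (algebraMap A B) ≤ maximalIdeal B ^ m ↔ m ≤ n := by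
    rw [hϖ.maximalIdeal_eq, hτ.maximalIdeal_eq, Ideal.map_span, Set.image_singleton,
      Ideal.span_singleton_pow, Ideal.span_singleton_le_span_singleton, hn.dvd_iff_dvd_right,
      pow_dvd_pow_iff hτ.ne_zero hτ.not_isUnit]
  rw [Ideal.ramificationIdx'_spec ((hle n).2 le_rfl) fun h => by simpa using (hle _).1 h] at he
  rw [he, pow_one] at hn
  exact hn.symm.irreducible hτ

/-- On models over compatible `p`-bases the map is injective modulo `ϖ`. Initiality transfers this
to arbitrary `U` and `V`: `U` maps to its model and back by the identity, and the square formed with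
`φ` commutes. -/
theorem IsUniversalResidualPerfection.dvd_of_dvd_map [IsLocalHom (algebraMap A B)]
    (hsep : IsSeparableFieldExtension (ResidueField A) (ResidueField B))
    (hϖ : Irreducible ϖ) (hϖB : Irreducible (algebraMap A B ϖ))
    {U V : Type u} [CommRing U] [Algebra A U] [CommRing V] [Algebra B V]
    (hU : IsUniversalResidualPerfection p A U) (hV : IsUniversalResidualPerfection p B V)
    (φ : U →+* V) (hφ : φ.comp (algebraMap A U) = (algebraMap B V).comp (algebraMap A B)) {u : U}
    (hu : algebraMap B V (algebraMap A B ϖ) ∣ φ u) : algebraMap A U ϖ ∣ u := by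
  obtain ⟨T, x, -, W, _, M, -, -, hx, hW⟩ := exists_perfectionModel_extending (p := p) hϖ
    (T := PEmpty) (x := PEmpty.elim) (isPIndependent_of_isEmpty _)
  obtain ⟨T', x', ι, W', _, M', hι, hxι, -, hW'⟩ := exists_perfectionModel_extending (p := p) hϖB
    (x := fun t => algebraMap A B (x t)) (hx.algebraMap_of_isSeparable hsep)
  obtain ⟨F, hF, hFinj⟩ := M.exists_hom_injective residue_surjective
    ((residue_eq_zero_iff_dvd hϖ ϖ).2 dvd_rfl) hx M' ((residue_eq_zero_iff_dvd hϖB _).2 dvd_rfl)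
    (algebraMap A B) rfl (algebraMap (ResidueField A) (ResidueField B)) rfl ι hι hxι
  have hUϖ := (isCompleteResidualPerfection_iff hϖ).1 hU.isCRP
  obtain ⟨α, hα⟩ := hU.exists_ringHom hϖ M.str hW
  obtain ⟨α', hα'⟩ := M.exists_hom (algebraMap A U) hUϖ
  obtain ⟨β, hβ⟩ := hV.exists_ringHom hϖB M'.str hW'
  have hα'ϖ : α' (M.str ϖ) = algebraMap A U ϖ := congrArg (fun f : A →+* U => f ϖ) hα'
  have hβϖ : β (algebraMap B V (algebraMap A B ϖ)) = M'.str (algebraMap A B ϖ) :=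
    congrArg (fun f : B →+* W' => f (algebraMap A B ϖ)) hβ
  have hid : RingHom.id U = α'.comp α := hU.ringHom_ext hϖ hUϖ (by
    rw [RingHom.comp_assoc, hα, hα', RingHom.id_comp])
  have hcomm : F.comp α = β.comp φ := hU.ringHom_ext hϖ
    (by
      have h1 : F (α (algebraMap A U ϖ)) = M'.str (algebraMap A B ϖ) :=
        (congrArg (fun f : A →+* W => F (f ϖ)) hα).trans (congrArg (fun f : A →+* W' => f ϖ) hF)
      rw [RingHom.comp_apply, h1]
      exact hW')
    (by rw [RingHom.comp_assoc, hα, hF, RingHom.comp_assoc, hφ, ← RingHom.comp_assoc, hβ])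
  have h1 : M'.str (algebraMap A B ϖ) ∣ F (α u) := by
    rw [← RingHom.comp_apply F α, hcomm, ← hβϖ]
    exact map_dvd β hu
  have h2 := map_dvd α' (hFinj _ h1)
  rwa [hα'ϖ, ← RingHom.comp_apply, ← hid] at h2

end Extension

theorem mainTheorem9 (p : ℕ) [Fact p.Prime]
    (A : Type u) [CommRing A] [IsDomain A] [IsDiscreteValuationRing A]
    [CharP (ResidueField A) p]
    (B : Type u) [CommRing B] [IsDomain B] [IsDiscreteValuationRing B]
    [Algebra A B] [IsLocalHom (algebraMap A B)]
    (hinj : Function.Injective (algebraMap A B))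
    (he : Ideal.ramificationIdx' (maximalIdeal A) (maximalIdeal B) = 1)
    (hsep : IsSeparableFieldExtension (ResidueField A) (ResidueField B)) :
    (∃ (Ag : Type u) (_ : CommRing Ag) (_ : Algebra A Ag),
      IsGenericResidualPerfection p A Ag) ∧
    (∃ (Bg : Type u) (_ : CommRing Bg) (_ : Algebra B Bg),
      IsGenericResidualPerfection p B Bg) ∧
    ∀ (Ag : Type u) [CommRing Ag] [Algebra A Ag]
      (Bg : Type u) [CommRing Bg] [Algebra B Bg] [Algebra A Bg] [IsScalarTower A B Bg],
      IsGenericResidualPerfection p A Ag → IsGenericResidualPerfection p B Bg →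
      ∃ f : Ag →ₐ[A] Bg, ∀ g : Ag →ₐ[A] Bg, g = f := by
  have : CharP (ResidueField B) p := charP_of_injective_algebraMap
    (algebraMap (ResidueField A) (ResidueField B)).injective p
  refine ⟨exists_isGenericResidualPerfection p A, exists_isGenericResidualPerfection p B, ?_⟩
  intro Ag _ _ Bg _ _ _ _ hAg hBg
  obtain ⟨ϖ, hϖ⟩ := IsDiscreteValuationRing.exists_irreducible A
  have hϖB := irreducible_algebraMap_of_ramificationIdx_eq_one hϖ hinj he
  obtain ⟨U, _, _, i, hU, hi⟩ := hAg.generic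
  obtain ⟨V, _, _, j, hV, hj⟩ := hBg.generic
  have hAgϖ := (isCompleteResidualPerfection_iff hϖ).1 hAg.isCRP
  have hBgϖ := (isCompleteResidualPerfection_iff hϖB).1 hBg.isCRP
  have hVϖ := (isCompleteResidualPerfection_iff hϖB).1 hV.isCRP
  -- The image of `ϖ` is a uniformizer of `B`, so `V` satisfies the conditions for a target over
  -- `A`.
  obtain ⟨φ, hφ⟩ := hU.exists_ringHom hϖ ((algebraMap B V).comp (algebraMap A B)) hVϖ
  have hjφ : ((j : V →+* Bg).comp φ).comp (algebraMap A U) = algebraMap A Bg := by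
    rw [RingHom.comp_assoc, hφ, ← RingHom.comp_assoc, IsScalarTower.algebraMap_eq A B Bg]
    exact congrArg (fun f : B →+* Bg => f.comp (algebraMap A B)) j.comp_algebraMap
  have hϖBg : (j : V →+* Bg).comp φ (algebraMap A U ϖ) = algebraMap B Bg (algebraMap A B ϖ) := by
    rw [← IsScalarTower.algebraMap_apply]
    exact congrArg (fun f : A →+* Bg => f ϖ) hjφ
  -- If `ϖ` does not divide `u`, it does not divide `φ u` either, so `j (φ u)` is a unit.
  obtain ⟨Ψ, hΨ, hΨu⟩ := existsUnique_extension hϖ hAgϖ.complete hAgϖ.regular hi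
    ((j : V →+* Bg).comp φ) (hϖBg ▸ hBgϖ.complete) fun u hu =>
      isUnit_of_not_dvd hϖB hBgϖ.complete hj fun h =>
        hu (hU.dvd_of_dvd_map hsep hϖ hϖB hV φ hφ h)
  refine ⟨{ Ψ with commutes' := fun a => ?_ }, fun g => ?_⟩
  · change Ψ (algebraMap A Ag a) = algebraMap A Bg a
    rw [← i.commutes, ← hjφ, ← hΨ]
    rfl
  -- Initiality of `U` determines `g` on `U`, and the extension from `U` to `Ag` is unique.
  · have hg : (g : Ag →+* Bg) = Ψ := hΨu _ (hU.ringHom_ext hϖ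
      (by
        change IsPerfectAdic p (g (i (algebraMap A U ϖ)))
        rw [i.commutes, g.commutes, IsScalarTower.algebraMap_apply A B Bg]
        exact hBgϖ)
      (by
        rw [hjφ]
        ext a
        change g (i (algebraMap A U a)) = _
        rw [i.commutes, g.commutes]))
    exact AlgHom.ext fun y => congrArg (fun f : Ag →+* Bg => f y) hg
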